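/- Let $n,j\ge 1$ be integers, $a<b$ real numbers, $0<\alpha\le 1$ and $\beta>0$. For $\gamma>0$ put $$I^{\gamma}_{a+}[f](t)=\int_a^t\frac{(t-s)^{\gamma-1}}{\Gamma(\gamma)}f(s)\,ds,\qquad I^{\gamma}_{b-}[f](t)=\int_t^b\frac{(s-t)^{\gamma-1}}{\Gamma(\gamma)}f(s)\,ds,$$ and $I^0_{a+}[f]=I^0_{b-}[f]=f$; whenever such a function is almost everywhere equal on $[a,b]$ to a continuous function, it is identified with that continuous function. Let $\mathrm{AC}^{\alpha}_{a+}$ (resp. $\mathrm{AC}^{\alpha}_{b-}$) be the set of $f\in L^1([a,b],\mathbb{R}^n)$ such that $I^{1-\alpha}_{a+}[f]$ (resp. $I^{1-\alpha}_{b-}[f]$) is absolutely continuous on $[a,b]$, and for such $f$ put $D^{\alpha}_{a+}[f]=\frac{d}{dt}I^{1-\alpha}_{a+}[f]$ (resp. $D^{\alpha}_{b-}[f]=-\frac{d}{dt}I^{1-\alpha}_{b-}[f]$), almost everywhere on $[a,b]$. Let ${}_c\mathrm{AC}^{\alpha,\infty}_{a+}$ be the set of continuous $x:[a,b]\to\mathbb{R}^n$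 with $x-x(a)\in \mathrm{AC}^{\alpha}_{a+}$ whose Caputo derivative ${}_cD^{\alpha}_{a+}[x]:=D^{\alpha}_{a+}[x-x(a)]$ is essentially bounded. Let $\varphi:\mathbb{R}^n\times\mathbb{R}^n\to\mathbb{R}$ and $L:\mathbb{R}^n\times\mathbb{R}^n\times[a,b]\to\mathbb{R}$ be of class $C^2$, let $g:\mathbb{R}^n\times\mathbb{R}^n\to\mathbb{R}^j$ be of class $C^1$, and let $S\subset\mathbb{R}^j$ be nonempty, closed and convex. Let $\mathrm{K}=\{x\in{}_c\mathrm{AC}^{\alpha,\infty}_{a+}: g(x(a),x(b))\in S\}$ and $$\mathcal{L}(x)=\varphi(x(a),x(b))+I^{\beta}_{a+}\big[L(x,{}_cD^{\alpha}_{a+}[x],\cdot)\big](b).$$ Suppose that $x\in\mathrm{K}$ minimizes $\mathcal{L}$ over $\mathrm{K}$ and that the differential of $g$ at $(x(a),x(b))$ is surjective. Put $u={}_cD^{\alpha}_{a+}[x]$ and $q(t)=\frac{(b-t)^{\beta-1}}{\Gamma(\beta)}\,\partial_2L(x(t),u(t),t)$. Then: (i) (Euler–Lagrange equation) $q\in\mathrm{AC}^{\alpha}_{b-}$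 and $$D^{\alpha}_{b-}[q](t)=-\frac{(b-t)^{\beta-1}}{\Gamma(\beta)}\,\partial_1L(x(t),u(t),t)\quad\text{for almost every }t\in[a,b];$$ (ii) (transversality conditions) there is $\psi\in\mathbb{R}^j$ with $-\psi\in \mathrm{N}_S[g(x(a),x(b))]$, where $\mathrm{N}_S[z]=\{z'\in\mathbb{R}^j:\ z'\cdot(z''-z)\le 0\ \ \forall z''\in S\}$, such that $$I^{1-\alpha}_{b-}[q](a)=\partial_1\varphi(x(a),x(b))-\partial_1g(x(a),x(b))^{\top}\psi,\qquad -I^{1-\alpha}_{b-}[q](b)=\partial_2\varphi(x(a),x(b))-\partial_2g(x(a),x(b))^{\top}\psi;$$ (iii) (Legendre condition) the matrix $\frac{(b-t)^{\beta-1}}{\Gamma(\beta)}\,\partial^2_{22}L(x(t),u(t),t)\in\mathbb{R}^{n\times n}$ is positive semidefinite for almost every $t\in[a,b]$. -/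

import Mathlib

open MeasureTheory Set

noncomputable section

namespace FracBolza

/-- The Euclidean space of dimension `n`. -/
abbrev Rn (n : ℕ) : Type := EuclideanSpace ℝ (Fin n)

section Operators

variable {F : Type*} [NormedAddCommGroup F] [NormedSpace ℝ F]

/-- Left Riemann-Liouville fractional integral of order `γ ≥ 0` on `[a, b]`, by its pointwise
formula (`t` ranges over `[a, b]`). -/
def leftRLIntegral (a γ : ℝ) (f : ℝ → F) (t : ℝ) : F :=
  if γ = 0 then f t else ∫ s in a..t, ((t - s) ^ (γ - 1) / Real.Gamma γ) • f s

/-- Right Riemann-Liouville fractional integral of order `γ ≥ 0` on `[a, b]`, by its pointwise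
formula (`t` ranges over `[a, b]`). -/
def rightRLIntegral (b γ : ℝ) (f : ℝ → F) (t : ℝ) : F :=
  if γ = 0 then f t else ∫ s in t..b, ((s - t) ^ (γ - 1) / Real.Gamma γ) • f s

open Classical in
/-- The continuous representative on `[a, b]` of `f`: a function that is continuous on `[a, b]`
and equal to `f` almost everywhere there, if there is one (its values on `[a, b]` are then
unique for `a < b`), and `f` itself otherwise. -/
def contRep (a b : ℝ) (f : ℝ → F) : ℝ → F :=
  if h : ∃ G : ℝ → F, ContinuousOn G (Icc a b) ∧ G =ᵐ[volume.restrict (Icc a b)] f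
  then h.choose else f

/-- `x` is integrable on `[a, b]` and has a left Riemann-Liouville derivative of order `α`: its
fractional integral of order `1 - α` is absolutely continuous (up to the choice of the
representative). -/
def LeftAC (a b α : ℝ) (x : ℝ → F) : Prop :=
  IntegrableOn x (Icc a b) volume ∧
    AbsolutelyContinuousOnInterval (contRep a b (leftRLIntegral a (1 - α) x)) a b

/-- Left Riemann-Liouville fractional derivative of order `α` (defined almost everywhere). -/
def leftRLDeriv (a b α : ℝ) (x : ℝ → F) (t : ℝ) : F :=
  deriv (contRep a b (leftRLIntegral a (1 - α) x)) t

/-- `x` is integrable on `[a, b]` and has a right Riemann-Liouville derivative of order `α`. -/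
def RightAC (a b α : ℝ) (x : ℝ → F) : Prop :=
  IntegrableOn x (Icc a b) volume ∧
    AbsolutelyContinuousOnInterval (contRep a b (rightRLIntegral b (1 - α) x)) a b

/-- Right Riemann-Liouville fractional derivative of order `α` (defined almost everywhere). -/
def rightRLDeriv (a b α : ℝ) (x : ℝ → F) (t : ℝ) : F :=
  -deriv (contRep a b (rightRLIntegral b (1 - α) x)) t

/-- Left Caputo fractional derivative of order `α`. -/
def caputoDeriv (a b α : ℝ) (x : ℝ → F) : ℝ → F :=
  leftRLDeriv a b α (fun t => x t - x a)

/-- The continuous functions on `[a, b]` that possess a left Caputo derivative of order `α` which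
is essentially bounded. Only the values on `[a, b]` matter. -/
def CaputoACInf (a b α : ℝ) : Set (ℝ → F) :=
  {x | ContinuousOn x (Icc a b) ∧ LeftAC a b α (fun t => x t - x a) ∧
    MemLp (caputoDeriv a b α x) ⊤ (volume.restrict (Icc a b))}

end Operators

/-- The fractional Bolza functional. -/
def bolza {n : ℕ} (a b α β : ℝ) (φ : Rn n × Rn n → ℝ) (L : Rn n × Rn n × ℝ → ℝ)
    (x : ℝ → Rn n) : ℝ :=
  φ (x a, x b) + leftRLIntegral a β (fun t => L (x t, caputoDeriv a b α x t, t)) b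

/-- The functions that satisfy the mixed initial/final constraint `g (x a, x b) ∈ S`. -/
def constraintSet {n j : ℕ} (a b α : ℝ) (g : Rn n × Rn n → Rn j) (S : Set (Rn j)) :
    Set (ℝ → Rn n) :=
  {x | x ∈ CaputoACInf a b α ∧ g (x a, x b) ∈ S}

/-- The normal cone to `S` at `z`. -/
def normalCone {j : ℕ} (S : Set (Rn j)) (z : Rn j) : Set (Rn j) :=
  {z' | ∀ z'' ∈ S, inner ℝ z' (z'' - z) ≤ 0}

/-- The Hessian matrix of `f` at `v`. -/
def hessianMatrix {n : ℕ} (f : Rn n → ℝ) (v : Rn n) : Matrix (Fin n) (Fin n) ℝ :=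
  Matrix.of fun i k =>
    fderiv ℝ (fderiv ℝ f) v (EuclideanSpace.single i 1) (EuclideanSpace.single k 1)

/-- The partial gradient of the Lagrangian `L (x, u, t)` in its first variable. -/
def gradL₁ {n : ℕ} (L : Rn n × Rn n × ℝ → ℝ) (x u : Rn n) (t : ℝ) : Rn n :=
  gradient (fun y => L (y, u, t)) x

/-- The partial gradient of the Lagrangian `L (x, u, t)` in its second variable. -/
def gradL₂ {n : ℕ} (L : Rn n × Rn n × ℝ → ℝ) (x u : Rn n) (t : ℝ) : Rn n :=
  gradient (fun v => L (x, v, t)) u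

/-- The function `t ↦ (b - t) ^ (β - 1) / Γ(β) • ∂₂L (x(t), ᶜD^α x(t), t)`. -/
def momentum {n : ℕ} (a b α β : ℝ) (L : Rn n × Rn n × ℝ → ℝ) (x : ℝ → Rn n) (t : ℝ) : Rn n :=
  ((b - t) ^ (β - 1) / Real.Gamma β) • gradL₂ L (x t) (caputoDeriv a b α x t) t

end FracBolza

end

open FracBolza

open FracBolza

namespace FracBolza

open Filter Topology Asymptotics

/-! Write I for the left integral of order α, I* for the right one, w(t) = (b-t)^{β-1}/Γ(β), and y₀
= (x(a), x(b)). The kernel identity behind I^{1-α} I^α = I^1 shows that adding c + I[v] to x, with v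
bounded, adds exactly v to its Caputo derivative (`CaputoACInf.add_rlOp`). Minimality thus becomes a
control problem in (c, v) (`IsOptimal`) with endpoint displacement (c, c + I[v](b)). Constant
controls already reach every displacement, so small endpoint errors can always be corrected by a
constant control of comparable size.

Multiplier. As Dg is onto at y₀, a map ρ tangent to the identity makes y ↦ g(y₀ + ρ(y)) affine near
0 (`exists_rectification`). A direction whose linearized endpoint value stays in the convex set S is
therefore admissible up to an o(ε) correction, and the first variation along it is nonnegative
(`IsOptimal.firstVar_nonneg`). Using both signs, it vanishes wherever Dg kills the endpoint
displacement, so it factors through Dg, which yields ψ; convex directions towards points of S give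
the normal cone condition.

Euler-Lagrange and transversality. Transposing I by Fubini in the identity for ψ gives q = -I*[w
∂₁L] - K(b,·) π₂, where K is the kernel of I and π = Dφ - ψ·Dg. Applying I^{1-α}_{b-} turns K(b,·)
into the constant 1, hence I^{1-α}_{b-}[q](t) = -∫_t^b w ∂₁L - π₂. Differentiation gives (i), the
endpoint values give (ii).

Legendre. A needle of width ε moves the state by as much as ε^α uniformly, but only by O(ε) in the
mean weighted by w, at Lebesgue points of I*[w]. The quadratic remainder, a product of the two
sizes, is o(ε). So the Weierstrass excess is nonnegative (`IsOptimal.ae_excess_nonneg`), and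
second-order calculus finishes. -/

/-! ### Estimates for the Riemann-Liouville kernel. -/

/-- The Riemann-Liouville kernel of order `α`. -/
noncomputable def rlKernel (α t s : ℝ) : ℝ :=
  if s < t then (t - s) ^ (α - 1) / Real.Gamma α else 0

theorem rlKernel_nonneg {α : ℝ} (hα : 0 < α) (t s : ℝ) : 0 ≤ rlKernel α t s := by
  unfold rlKernel
  split_ifs with h
  · exact div_nonneg (Real.rpow_nonneg (by linarith) _) (Real.Gamma_pos_of_pos hα).le
  · exact le_rfl

theorem rlKernel_of_le {α t s : ℝ} (h : t ≤ s) : rlKernel α t s = 0 := if_neg h.not_gt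

theorem rlKernel_of_lt {α t s : ℝ} (h : s < t) :
    rlKernel α t s = (t - s) ^ (α - 1) / Real.Gamma α := if_pos h

theorem measurable_rlKernel (α : ℝ) : Measurable (fun p : ℝ × ℝ => rlKernel α p.1 p.2) := by
  unfold rlKernel
  refine Measurable.ite (measurableSet_lt measurable_snd measurable_fst) ?_ measurable_const
  fun_prop

theorem measurable_rlKernel_left (α t : ℝ) : Measurable (rlKernel α t) :=
  (measurable_rlKernel α).comp (measurable_const.prodMk measurable_id)

theorem measurable_rlKernel_right (α s : ℝ) : Measurable (fun t => rlKernel α t s) :=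
  (measurable_rlKernel α).comp (measurable_id.prodMk measurable_const)

theorem rlKernel_anti {α : ℝ} (hα : 0 < α) (hα1 : α ≤ 1) {t t' s : ℝ} (hs : s < t) (h : t ≤ t') :
    rlKernel α t' s ≤ rlKernel α t s := by
  rw [rlKernel_of_lt hs, rlKernel_of_lt (hs.trans_le h)]
  have := (Real.Gamma_pos_of_pos hα).le
  gcongr ?_ / _
  exact Real.rpow_le_rpow_of_nonpos (by linarith) (by linarith) (by linarith)

theorem intervalIntegrable_rpow_sub {α : ℝ} (hα : 0 < α) (c t : ℝ) :
    IntervalIntegrable (fun s => (t - s) ^ (α - 1) / Real.Gamma α) volume c t := by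
  have h := (intervalIntegral.intervalIntegrable_rpow' (a := t - c) (b := 0) (r := α - 1)
    (by linarith)).comp_sub_left t
  simp only [sub_sub_cancel, sub_zero] at h
  exact h.div_const _

theorem integral_rpow_sub {α : ℝ} (hα : 0 < α) (c t : ℝ) :
    ∫ s in c..t, (t - s) ^ (α - 1) / Real.Gamma α = (t - c) ^ α / Real.Gamma (α + 1) := by
  rw [intervalIntegral.integral_div,
    intervalIntegral.integral_comp_sub_left (fun s => s ^ (α - 1)) t,
    integral_rpow (Or.inl (by linarith)), Real.Gamma_add_one hα.ne']
  simp [Real.zero_rpow hα.ne', div_div]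

theorem integrableOn_rlKernel_Ioi {α : ℝ} (hα : 0 < α) (t c : ℝ) :
    IntegrableOn (rlKernel α t) (Ioi c) := by
  have h0 : IntegrableOn (rlKernel α t) (Ici t) :=
    (integrableOn_zero : IntegrableOn (fun _ => (0 : ℝ)) (Ici t)).congr_fun (fun s hs => (rlKernel_of_le hs).symm) measurableSet_Ici
  rcases le_total t c with h | h
  · exact h0.mono_set ((Ioi_subset_Ioi h).trans Ioi_subset_Ici_self)
  · have h1 : IntegrableOn (rlKernel α t) (Ioo c t) :=
      ((intervalIntegrable_iff_integrableOn_Ioo_of_le h).1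
        (intervalIntegrable_rpow_sub hα c t)).congr_fun
        (fun s hs => (rlKernel_of_lt hs.2).symm) measurableSet_Ioo
    refine (h1.union h0).mono_set fun s hs => ?_
    rcases lt_or_ge s t with h' | h'
    exacts [Or.inl ⟨hs, h'⟩, Or.inr h']

theorem integrableOn_rlKernel {α : ℝ} (hα : 0 < α) (t a b : ℝ) :
    IntegrableOn (rlKernel α t) (Icc a b) :=
  (integrableOn_rlKernel_Ioi hα t (a - 1)).mono_set fun s hs => by
    have := hs.1
    simp only [mem_Ioi]; linarith

theorem setIntegral_rlKernel_smul {F : Type*} [NormedAddCommGroup F] [NormedSpace ℝ F]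
    {α a b t : ℝ} (ht : t ∈ Icc a b) (f : ℝ → F) :
    ∫ s in Icc a b, rlKernel α t s • f s = ∫ s in a..t, ((t - s) ^ (α - 1) / Real.Gamma α) • f s := by
  rw [intervalIntegral.integral_of_le ht.1, integral_Icc_eq_integral_Ioc,
    integral_Ioc_eq_integral_Ioo (y := t),
    setIntegral_eq_of_subset_of_forall_sdiff_eq_zero (s := Ioo a t)
      (f := fun s => rlKernel α t s • f s) measurableSet_Ioc
      (fun s hs => ⟨hs.1, hs.2.le.trans ht.2⟩)]
  · exact setIntegral_congr_fun measurableSet_Ioo fun s hs => by rw [rlKernel_of_lt hs.2]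
  · intro s hs
    rw [rlKernel_of_le, zero_smul]
    by_contra! h
    exact hs.2 ⟨hs.1.1, h⟩

theorem setIntegral_rlKernel_smul_right {F : Type*} [NormedAddCommGroup F] [NormedSpace ℝ F]
    {α a b s : ℝ} (hs : s ∈ Icc a b) (f : ℝ → F) :
    ∫ t in Icc a b, rlKernel α t s • f t = ∫ t in s..b, ((t - s) ^ (α - 1) / Real.Gamma α) • f t := by
  rw [intervalIntegral.integral_of_le hs.2, integral_Icc_eq_integral_Ioc,
    setIntegral_eq_of_subset_of_forall_sdiff_eq_zero (s := Ioc s b)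
      (f := fun t => rlKernel α t s • f t) measurableSet_Ioc
      (fun t ht => ⟨hs.1.trans_lt ht.1, ht.2⟩)]
  · exact setIntegral_congr_fun measurableSet_Ioc fun t ht => by rw [rlKernel_of_lt ht.1]
  · intro t ht
    rw [rlKernel_of_le, zero_smul]
    by_contra! h
    exact ht.2 ⟨h, ht.1.2⟩

theorem setIntegral_rlKernel {α : ℝ} (hα : 0 < α) {a b t : ℝ} (ht : t ∈ Icc a b) :
    ∫ s in Icc a b, rlKernel α t s = (t - a) ^ α / Real.Gamma (α + 1) := by
  rw [← integral_rpow_sub hα]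
  simpa using setIntegral_rlKernel_smul (α := α) ht (fun _ => (1 : ℝ))

/-- For t beyond d, monotonicity of the kernel in t (α ≤ 1) reduces to t = d. Uniformity in t is
what later controls the effect of a short needle on the whole trajectory. -/
theorem setIntegral_rlKernel_Icc_le {α : ℝ} (hα : 0 < α) (hα1 : α ≤ 1) {c d : ℝ} (hcd : c ≤ d)
    (t : ℝ) : ∫ s in Icc c d, rlKernel α t s ≤ (d - c) ^ α / Real.Gamma (α + 1) := by
  have hG := (Real.Gamma_pos_of_pos (by linarith : 0 < α + 1)).le
  rcases le_total t c with h | h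
  · rw [setIntegral_congr_fun (g := fun _ => (0 : ℝ)) measurableSet_Icc
      (fun s hs => rlKernel_of_le (h.trans hs.1))]
    simp only [integral_zero]
    exact div_nonneg (Real.rpow_nonneg (by linarith) _) hG
  rcases le_total t d with h' | h'
  · rw [setIntegral_rlKernel hα ⟨h, h'⟩]
    gcongr
  · rw [← setIntegral_rlKernel hα (right_mem_Icc.2 hcd), integral_Icc_eq_integral_Ico,
      integral_Icc_eq_integral_Ico]
    exact setIntegral_mono_on ((integrableOn_rlKernel hα t c d).mono_set Ico_subset_Icc_self)
      ((integrableOn_rlKernel hα d c d).mono_set Ico_subset_Icc_self) measurableSet_Ico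
      fun s hs => rlKernel_anti hα hα1 hs.2 h'

/-- Passing from t to t' lowers the kernel before t and creates new mass only on [t, t']. The total
mass does not decrease, so the loss is at most the gain, and the gain is explicit. -/
theorem setIntegral_abs_rlKernel_sub_le {α : ℝ} (hα : 0 < α) (hα1 : α ≤ 1) {a b t t' : ℝ}
    (ht : t ∈ Icc a b) (ht' : t' ∈ Icc a b) (h : t ≤ t') :
    ∫ s in Icc a b, |rlKernel α t' s - rlKernel α t s| ≤
      2 * ((t' - t) ^ α / Real.Gamma (α + 1)) := by
  have hG := (Real.Gamma_pos_of_pos (by linarith : 0 < α + 1)).le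
  have hI := integrableOn_rlKernel hα t a b
  have hI' := integrableOn_rlKernel hα t' a b
  have hE : ∀ s, |rlKernel α t' s - rlKernel α t s| =
      rlKernel α t s - rlKernel α t' s + 2 * (Icc t t').indicator (rlKernel α t') s := by
    intro s
    rcases lt_or_ge s t with h1 | h1
    · rw [indicator_of_notMem (fun hs => h1.not_ge hs.1), abs_sub_comm, abs_of_nonneg
        (sub_nonneg.2 (rlKernel_anti hα hα1 h1 h))]
      ring
    · rw [rlKernel_of_le h1, sub_zero, abs_of_nonneg (rlKernel_nonneg hα _ _)]
      by_cases h2 : s ≤ t'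
      · rw [indicator_of_mem (show s ∈ Icc t t' from ⟨h1, h2⟩)]; ring
      · rw [indicator_of_notMem (fun hs => h2 hs.2), rlKernel_of_le (not_le.1 h2).le]; ring
  have hI2 : IntegrableOn ((Icc t t').indicator (rlKernel α t')) (Icc a b) :=
    hI'.indicator measurableSet_Icc
  simp only [hE]
  rw [integral_add (f := fun s => rlKernel α t s - rlKernel α t' s) (hI.sub hI')
    (hI2.const_mul 2), integral_sub hI hI', integral_const_mul,
    setIntegral_indicator measurableSet_Icc,
    inter_eq_right.2 (Icc_subset_Icc ht.1 ht'.2), setIntegral_rlKernel hα ht,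
    setIntegral_rlKernel hα ht', setIntegral_rlKernel hα (right_mem_Icc.2 h)]
  have : (t - a) ^ α / Real.Gamma (α + 1) ≤ (t' - a) ^ α / Real.Gamma (α + 1) := by
    have := ht.1
    gcongr
  linarith

/-! ### Beta integrals and composition of kernels. -/

/-- Rescaling t to (t - s)/(r - s) turns the product into a beta density, since B(α, 1-α) =
Γ(α)Γ(1-α). -/
theorem rlKernel_mul_rlKernel {α : ℝ} (hα : 0 < α) {s r : ℝ} (hsr : s < r) (t : ℝ) :
    rlKernel (1 - α) r t * rlKernel α t s =
      (r - s)⁻¹ * ProbabilityTheory.betaPDFReal α (1 - α) ((t - s) / (r - s)) := by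
  have hrs : 0 < r - s := sub_pos.2 hsr
  unfold ProbabilityTheory.betaPDFReal
  by_cases h1 : s < t
  · by_cases h2 : t < r
    · have hc : 0 < (t - s) / (r - s) ∧ (t - s) / (r - s) < 1 :=
        ⟨div_pos (sub_pos.2 h1) hrs, (div_lt_one hrs).2 (by linarith)⟩
      rw [rlKernel_of_lt h1, rlKernel_of_lt h2, if_pos hc, ProbabilityTheory.beta]
      have h3 : 1 - (t - s) / (r - s) = (r - t) / (r - s) := by field_simp; ring
      have h4 : (r - s) ^ (α - 1) * (r - s) ^ (1 - α - 1) = (r - s)⁻¹ := by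
        rw [← Real.rpow_add hrs, ← Real.rpow_neg_one]; ring_nf
      rw [h3, Real.div_rpow (by linarith) hrs.le, Real.div_rpow (by linarith) hrs.le]
      have h5 : α + (1 - α) = 1 := by ring
      rw [h5, Real.Gamma_one]
      have h6 := (Real.rpow_pos_of_pos hrs (α - 1)).ne'
      have h7 := (Real.rpow_pos_of_pos hrs (1 - α - 1)).ne'
      rw [← h4]
      field_simp
    · rw [rlKernel_of_le (not_lt.1 h2), if_neg, zero_mul, mul_zero]
      rintro ⟨-, h⟩
      rw [div_lt_one hrs] at h
      exact h2 (by linarith)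
  · rw [rlKernel_of_le (t := t) (not_lt.1 h1), if_neg, mul_zero, mul_zero]
    rintro ⟨h, -⟩
    exact absurd ((div_pos_iff_of_pos_right hrs).1 h) (by linarith [not_lt.1 h1])

theorem integrable_betaPDFReal {α β : ℝ} (hα : 0 < α) (hβ : 0 < β) :
    Integrable (ProbabilityTheory.betaPDFReal α β) ∧
      ∫ x, ProbabilityTheory.betaPDFReal α β x = 1 := by
  have hn : 0 ≤ᵐ[volume] ProbabilityTheory.betaPDFReal α β := by
    refine ae_of_all _ fun x => ?_
    by_cases h : 0 < x ∧ x < 1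
    · exact (ProbabilityTheory.betaPDFReal_pos h.1 h.2 hα hβ).le
    · simp [ProbabilityTheory.betaPDFReal, h]
  have hm := (ProbabilityTheory.measurable_betaPDFReal α β)
  have h1 := ProbabilityTheory.lintegral_betaPDF_eq_one hα hβ
  unfold ProbabilityTheory.betaPDF at h1
  refine ⟨⟨hm.aestronglyMeasurable, ?_⟩, ?_⟩
  · rw [hasFiniteIntegral_iff_ofReal hn, h1]; exact ENNReal.one_lt_top
  · rw [integral_eq_lintegral_of_nonneg_ae hn hm.aestronglyMeasurable, h1]; rfl

/-- A beta density has total mass 1 whatever the length r - s. This is I^{1-α} I^α = I^1 at the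
level of kernels. -/
theorem integrable_rlKernel_mul {α : ℝ} (hα : 0 < α) (hα1 : α < 1) (s r : ℝ) :
    Integrable (fun t => rlKernel (1 - α) r t * rlKernel α t s) ∧
      ∫ t, rlKernel (1 - α) r t * rlKernel α t s = if s < r then 1 else 0 := by
  split_ifs with hsr
  · obtain ⟨h1, h2⟩ := integrable_betaPDFReal hα (sub_pos.2 hα1)
    have hrs : 0 < r - s := sub_pos.2 hsr
    simp only [rlKernel_mul_rlKernel hα hsr]
    refine ⟨((h1.comp_div hrs.ne').comp_sub_right s).const_mul _, ?_⟩
    rw [integral_const_mul, integral_sub_right_eq_self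
      (fun t => ProbabilityTheory.betaPDFReal α (1 - α) (t / (r - s))) s,
      Measure.integral_comp_div (ProbabilityTheory.betaPDFReal α (1 - α)), h2, abs_of_pos hrs]
    simp [hrs.ne']
  · have : (fun t => rlKernel (1 - α) r t * rlKernel α t s) = fun _ => 0 := by
      funext t
      rcases lt_or_ge s t with h | h
      · rw [rlKernel_of_le ((not_lt.1 hsr).trans h.le), zero_mul]
      · rw [rlKernel_of_le (s := s) h, mul_zero]
    simp [this]

theorem setIntegral_rlKernel_mul {α : ℝ} (hα : 0 < α) (hα1 : α < 1) {a b s r : ℝ}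
    (hs : s ∈ Icc a b) (hr : r ∈ Icc a b) :
    ∫ t in Icc a b, rlKernel (1 - α) r t * rlKernel α t s = if s < r then 1 else 0 := by
  rw [← (integrable_rlKernel_mul hα hα1 s r).2]
  refine setIntegral_eq_integral_of_forall_compl_eq_zero fun t ht => ?_
  rcases lt_or_ge s t with h | h
  · rcases lt_or_ge t r with h' | h'
    · exact absurd ⟨hs.1.trans h.le, h'.le.trans hr.2⟩ ht
    · rw [rlKernel_of_le h', zero_mul]
  · rw [rlKernel_of_le (s := s) h, mul_zero]

/-- Fubini for the composition of a weight and a nonnegative kernel. -/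
theorem integral_kernel_comp {F : Type*} [NormedAddCommGroup F] [NormedSpace ℝ F]
    [CompleteSpace F] {μ : Measure ℝ} [SFinite μ] {k : ℝ → ℝ} {K : ℝ → ℝ → ℝ} {J : ℝ → ℝ} {C : ℝ} {f : ℝ → F}
    (hk : Measurable k) (hK : Measurable (fun p : ℝ × ℝ => K p.1 p.2))
    (hk0 : ∀ t, 0 ≤ k t) (hK0 : ∀ t s, 0 ≤ K t s)
    (hi : ∀ᵐ s ∂μ, Integrable (fun t => k t * K t s) μ)
    (hJ : ∀ᵐ s ∂μ, ∫ t, k t * K t s ∂μ = J s) (hJC : ∀ s, |J s| ≤ C) (hf : Integrable f μ) :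
    Integrable (fun t => k t • ∫ s, K t s • f s ∂μ) μ ∧
      ∫ t, k t • ∫ s, K t s • f s ∂μ ∂μ = ∫ s, J s • f s ∂μ := by
  have hm : AEStronglyMeasurable (fun p : ℝ × ℝ => (k p.1 * K p.1 p.2) • f p.2) (μ.prod μ) :=
    (((hk.comp measurable_fst).mul hK).aestronglyMeasurable).smul hf.1.comp_snd
  have hJm : AEStronglyMeasurable J μ := by
    have h : AEStronglyMeasurable (fun s => ∫ t, k t * K t s ∂μ) μ :=
      (StronglyMeasurable.integral_prod_right (f := fun s t => k t * K t s)
        ((hk.comp measurable_snd).mul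
          (hK.comp measurable_swap)).stronglyMeasurable).aestronglyMeasurable
    exact h.congr hJ
  -- Nonnegativity of the kernels lets the norm be integrated in t first, which leaves the bounded
  -- factor J times ‖f‖.
  have hint : Integrable (fun p : ℝ × ℝ => (k p.1 * K p.1 p.2) • f p.2) (μ.prod μ) := by
    rw [integrable_prod_iff' hm]
    refine ⟨?_, ?_⟩
    · filter_upwards [hi] with s hs using hs.smul_const _
    · have h1 : Integrable (fun s => J s * ‖f s‖) μ :=
        hf.norm.bdd_mul hJm (ae_of_all _ hJC)
      refine h1.congr ?_
      filter_upwards [hJ] with s hs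
      simp only [norm_smul, Real.norm_of_nonneg (mul_nonneg (hk0 _) (hK0 _ _))]
      rw [integral_mul_const, hs]
  have := integral_integral_swap (f := fun t s => (k t * K t s) • f s) hint
  simp only [mul_smul, integral_smul] at this
  refine ⟨by simpa only [mul_smul, integral_smul] using hint.integral_prod_left, ?_⟩
  rw [this]
  refine integral_congr_ae ?_
  filter_upwards [hJ] with s hs
  simp only [← mul_smul]
  rw [integral_smul_const, hs]

/-! ### The fractional integrals as kernel operators on [a, b]. -/

section Operators

variable {F : Type*} [NormedAddCommGroup F] [NormedSpace ℝ F]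

/-- The left Riemann-Liouville integral on `[a, b]`, written with the kernel. -/
noncomputable def rlOp (a b α : ℝ) (v : ℝ → F) (t : ℝ) : F :=
  ∫ s in Icc a b, rlKernel α t s • v s

/-- The right Riemann-Liouville integral on `[a, b]`, written with the kernel. -/
noncomputable def rlAdj (a b α : ℝ) (f : ℝ → F) (s : ℝ) : F :=
  ∫ t in Icc a b, rlKernel α t s • f t

variable {a b α : ℝ}

theorem leftRLIntegral_eq_rlOp (hα : 0 < α) {t : ℝ} (ht : t ∈ Icc a b) (f : ℝ → F) :
    leftRLIntegral a α f t = rlOp a b α f t := by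
  rw [leftRLIntegral, if_neg hα.ne', rlOp, setIntegral_rlKernel_smul ht]

theorem rightRLIntegral_eq_rlAdj (hα : 0 < α) {t : ℝ} (ht : t ∈ Icc a b) (f : ℝ → F) :
    rightRLIntegral b α f t = rlAdj a b α f t := by
  rw [rightRLIntegral, if_neg hα.ne', rlAdj, setIntegral_rlKernel_smul_right ht]

theorem measurable_rlOp {v : ℝ → F} (hv : StronglyMeasurable v) :
    StronglyMeasurable (rlOp a b α v) :=
  StronglyMeasurable.integral_prod_right (f := fun t s => rlKernel α t s • v s)
    ((measurable_rlKernel α).stronglyMeasurable.smul (hv.comp_measurable measurable_snd))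

theorem integrableOn_rlKernel_smul (hα : 0 < α) (t : ℝ) {v : ℝ → F} {M : ℝ}
    (hv : AEStronglyMeasurable v (volume.restrict (Icc a b))) (hM : ∀ s ∈ Icc a b, ‖v s‖ ≤ M) :
    IntegrableOn (fun s => rlKernel α t s • v s) (Icc a b) := by
  refine (integrableOn_rlKernel hα t a b).smul_bdd M hv ?_
  exact ae_restrict_of_forall_mem measurableSet_Icc hM

theorem norm_rlOp_le_rlOp_norm (hα : 0 < α) (v : ℝ → F) (t : ℝ) :
    ‖rlOp a b α v t‖ ≤ rlOp a b α (fun s => ‖v s‖) t := by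
  refine (norm_integral_le_integral_norm _).trans_eq ?_
  simp only [norm_smul, Real.norm_of_nonneg (rlKernel_nonneg hα _ _), smul_eq_mul, rlOp]

theorem norm_rlOp_le (hab : a ≤ b) (hα : 0 < α) (hα1 : α ≤ 1) {v : ℝ → F} {M : ℝ}
    (hv : AEStronglyMeasurable v (volume.restrict (Icc a b)))
    (hM : ∀ s ∈ Icc a b, ‖v s‖ ≤ M) (t : ℝ) :
    ‖rlOp a b α v t‖ ≤ (b - a) ^ α / Real.Gamma (α + 1) * M := by
  have hM0 : 0 ≤ M := (norm_nonneg _).trans (hM a (left_mem_Icc.2 hab))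
  refine (norm_rlOp_le_rlOp_norm hα v t).trans ?_
  refine (setIntegral_mono_on (g := fun s => rlKernel α t s * M) ?_
    ((integrableOn_rlKernel hα t a b).mul_const M) measurableSet_Icc ?_).trans ?_
  · exact integrableOn_rlKernel_smul hα t hv.norm (M := M) (by simpa using hM)
  · intro s hs
    exact mul_le_mul_of_nonneg_left (hM s hs) (rlKernel_nonneg hα _ _)
  · rw [integral_mul_const]
    exact mul_le_mul_of_nonneg_right (setIntegral_rlKernel_Icc_le hα hα1 hab t) hM0

theorem rlOp_add (hα : 0 < α) {v v' : ℝ → F} {M M' : ℝ}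
    (hv : AEStronglyMeasurable v (volume.restrict (Icc a b))) (hM : ∀ s ∈ Icc a b, ‖v s‖ ≤ M)
    (hv' : AEStronglyMeasurable v' (volume.restrict (Icc a b)))
    (hM' : ∀ s ∈ Icc a b, ‖v' s‖ ≤ M') (t : ℝ) :
    rlOp a b α (fun s => v s + v' s) t = rlOp a b α v t + rlOp a b α v' t := by
  simp only [rlOp, smul_add]
  exact integral_add (integrableOn_rlKernel_smul hα t hv hM)
    (integrableOn_rlKernel_smul hα t hv' hM')

theorem rlOp_smul (r : ℝ) (v : ℝ → F) (t : ℝ) :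
    rlOp a b α (fun s => r • v s) t = r • rlOp a b α v t := by
  simp only [rlOp, smul_comm _ r, integral_smul]

theorem rlOp_const [CompleteSpace F] (k : F) (t : ℝ) :
    rlOp a b α (fun _ => k) t = rlOp a b α (fun _ => (1 : ℝ)) t • k := by
  simp only [rlOp, integral_smul_const, smul_eq_mul, mul_one]

theorem rlOp_left (v : ℝ → F) : rlOp a b α v a = 0 := by
  rw [rlOp, setIntegral_congr_fun (g := fun _ => (0 : F)) measurableSet_Icc
    (fun s hs => by simp [rlKernel_of_le hs.1])]
  simp

/-- The L¹ modulus of the kernel makes the image of a bounded function Hölder continuous of exponent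
α. -/
theorem continuousOn_rlOp (hα : 0 < α) (hα1 : α ≤ 1) {v : ℝ → F} {M : ℝ}
    (hv : AEStronglyMeasurable v (volume.restrict (Icc a b)))
    (hM : ∀ s ∈ Icc a b, ‖v s‖ ≤ M) :
    ContinuousOn (rlOp a b α v) (Icc a b) := by
  rcases lt_or_ge b a with hab | hab
  · simp [Icc_eq_empty hab.not_ge]
  have hM0 : 0 ≤ M := (norm_nonneg _).trans (hM a (left_mem_Icc.2 hab))
  have key : ∀ t ∈ Icc a b, ∀ t' ∈ Icc a b, t ≤ t' →
      ‖rlOp a b α v t' - rlOp a b α v t‖ ≤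
        2 * (|t' - t| ^ α / Real.Gamma (α + 1)) * M := by
    intro t ht t' ht' h
    rw [abs_of_nonneg (sub_nonneg.2 h), rlOp, rlOp,
      ← integral_sub (integrableOn_rlKernel_smul hα t' hv hM)
        (integrableOn_rlKernel_smul hα t hv hM)]
    simp only [← sub_smul]
    refine (norm_integral_le_integral_norm _).trans ?_
    have hI : IntegrableOn (fun s => rlKernel α t' s - rlKernel α t s) (Icc a b) :=
      (integrableOn_rlKernel hα t' a b).sub (integrableOn_rlKernel hα t a b)
    have hb : ∀ᵐ s ∂(volume.restrict (Icc a b)), ‖v s‖ ≤ M :=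
      ae_restrict_of_forall_mem measurableSet_Icc hM
    refine (setIntegral_mono_on (g := fun s => |rlKernel α t' s - rlKernel α t s| * M)
      (hI.smul_bdd M hv hb).norm (hI.abs.mul_const M) measurableSet_Icc ?_).trans ?_
    · intro s hs
      simp only [Pi.smul_apply', norm_smul, Real.norm_eq_abs]
      exact mul_le_mul_of_nonneg_left (hM s hs) (abs_nonneg _)
    · rw [integral_mul_const]
      exact mul_le_mul_of_nonneg_right (setIntegral_abs_rlKernel_sub_le hα hα1 ht ht' h) hM0
  intro t ht
  rw [ContinuousWithinAt, tendsto_iff_norm_sub_tendsto_zero]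
  have hlim : Tendsto (fun t' => 2 * (|t' - t| ^ α / Real.Gamma (α + 1)) * M)
      (𝓝[Icc a b] t) (𝓝 0) := by
    have h1 : Continuous (fun t' => 2 * (|t' - t| ^ α / Real.Gamma (α + 1)) * M) := by
      have : Continuous fun t' : ℝ => |t' - t| ^ α :=
        (continuous_abs.comp (continuous_id.sub continuous_const)).rpow_const
          fun _ => Or.inr hα.le
      fun_prop
    have h2 := h1.tendsto t
    simp only [sub_self, abs_zero, Real.zero_rpow hα.ne', zero_div, mul_zero, zero_mul] at h2
    exact h2.mono_left nhdsWithin_le_nhds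
  refine squeeze_zero' (Eventually.of_forall fun _ => norm_nonneg _) ?_ hlim
  filter_upwards [self_mem_nhdsWithin] with t' ht'
  rcases le_total t t' with h | h
  · exact key t ht t' ht' h
  · rw [norm_sub_rev, abs_sub_comm]
    exact key t' ht' t ht h

/-- The mass of the kernel in s is bounded uniformly in t, so an f that is merely integrable
suffices for Fubini. This matters because the weight is unbounded at b when β < 1. -/
theorem integrableOn_prod_rlKernel_smul (hab : a ≤ b) (hα : 0 < α) (hα1 : α ≤ 1) {f : ℝ → F}
    (hf : IntegrableOn f (Icc a b)) :
    Integrable (fun p : ℝ × ℝ => rlKernel α p.1 p.2 • f p.1)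
      ((volume.restrict (Icc a b)).prod (volume.restrict (Icc a b))) := by
  have hK : AEStronglyMeasurable (fun p : ℝ × ℝ => rlKernel α p.1 p.2 • f p.1)
      ((volume.restrict (Icc a b)).prod (volume.restrict (Icc a b))) :=
    (measurable_rlKernel α).aestronglyMeasurable.smul hf.aestronglyMeasurable.comp_fst
  rw [integrable_prod_iff hK]
  refine ⟨ae_of_all _ fun t => (integrableOn_rlKernel hα t a b).smul_const (f t), ?_⟩
  simp only [norm_smul, Real.norm_of_nonneg (rlKernel_nonneg hα _ _), integral_mul_const]
  have hm : AEStronglyMeasurable (fun t => ∫ s in Icc a b, rlKernel α t s)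
      (volume.restrict (Icc a b)) :=
    (StronglyMeasurable.integral_prod_right (f := fun t s => rlKernel α t s)
      (measurable_rlKernel α).stronglyMeasurable).aestronglyMeasurable
  refine hf.norm.bdd_mul (c := (b - a) ^ α / Real.Gamma (α + 1)) hm (ae_of_all _ fun t => ?_)
  rw [Real.norm_of_nonneg (integral_nonneg fun s => rlKernel_nonneg hα _ _)]
  exact setIntegral_rlKernel_Icc_le hα hα1 hab t

theorem integrableOn_rlAdj (hab : a ≤ b) (hα : 0 < α) (hα1 : α ≤ 1) {f : ℝ → F}
    (hf : IntegrableOn f (Icc a b)) : IntegrableOn (rlAdj a b α f) (Icc a b) :=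
  (integrableOn_prod_rlKernel_smul hab hα hα1 hf).integral_prod_right

variable [CompleteSpace F]

theorem rlOp_comp (hα : 0 < α) (hα1 : α < 1) {f : ℝ → F} (hf : IntegrableOn f (Icc a b))
    {r : ℝ} (hr : r ∈ Icc a b) :
    rlOp a b (1 - α) (rlOp a b α f) r = ∫ s in a..r, f s := by
  have := integral_kernel_comp (μ := volume.restrict (Icc a b)) (k := rlKernel (1 - α) r)
    (K := rlKernel α) (J := fun s => if s < r then (1 : ℝ) else 0) (C := 1)
    (measurable_rlKernel_left _ _)
    (measurable_rlKernel α) (rlKernel_nonneg (sub_pos.2 hα1) r) (rlKernel_nonneg hα)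
    (ae_of_all _ fun s => (integrable_rlKernel_mul hα hα1 s r).1.integrableOn)
    (ae_restrict_of_forall_mem measurableSet_Icc
      fun s hs => setIntegral_rlKernel_mul hα hα1 hs hr)
    (fun s => by split_ifs <;> simp) hf
  refine this.2.trans ?_
  have h2 := setIntegral_rlKernel_smul (α := 1) hr f
  simp only [sub_self, Real.rpow_zero, Real.Gamma_one, div_one, one_smul] at h2
  rw [← h2]
  simp [rlKernel]

theorem rlAdj_comp (hα : 0 < α) (hα1 : α < 1) {f : ℝ → F} (hf : IntegrableOn f (Icc a b))
    {r : ℝ} (hr : r ∈ Icc a b) :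
    IntegrableOn (fun t => rlKernel (1 - α) t r • rlAdj a b α f t) (Icc a b) ∧
      rlAdj a b (1 - α) (rlAdj a b α f) r = ∫ s in r..b, f s := by
  -- The right-sided composition is the left-sided kernel identity with α and 1 - α exchanged.
  have h1 : ∀ s t, rlKernel (1 - α) t r * rlKernel α s t =
      rlKernel (1 - (1 - α)) s t * rlKernel (1 - α) t r := by
    intro s t; rw [mul_comm, sub_sub_cancel]
  have h0 : (1 - α) < 1 := by linarith
  have := integral_kernel_comp (μ := volume.restrict (Icc a b))
    (k := fun t => rlKernel (1 - α) t r)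
    (K := fun t s => rlKernel α s t) (J := fun s => if r < s then (1 : ℝ) else 0) (C := 1)
    (measurable_rlKernel_right _ _)
    ((measurable_rlKernel α).comp measurable_swap) (fun t => rlKernel_nonneg (sub_pos.2 hα1) t r)
    (fun t s => rlKernel_nonneg hα s t)
    (ae_of_all _ fun s => by
      simp only [h1]
      exact (integrable_rlKernel_mul (sub_pos.2 hα1) h0 r s).1.integrableOn)
    (ae_restrict_of_forall_mem measurableSet_Icc
      fun s hs => by
        simp only [h1]
        exact setIntegral_rlKernel_mul (sub_pos.2 hα1) h0 hr hs)
    (fun s => by split_ifs <;> simp) hf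
  refine ⟨this.1, this.2.trans ?_⟩
  have h2 := setIntegral_rlKernel_smul_right (α := 1) hr f
  simp only [sub_self, Real.rpow_zero, Real.Gamma_one, div_one, one_smul] at h2
  rw [← h2]
  simp [rlKernel]

end Operators

theorem integral_inner_rlOp {E : Type*} [NormedAddCommGroup E] [InnerProductSpace ℝ E]
    [CompleteSpace E] {a b α : ℝ} (hab : a ≤ b) (hα : 0 < α) (hα1 : α ≤ 1) {f v : ℝ → E} {M : ℝ}
    (hf : IntegrableOn f (Icc a b)) (hv : AEStronglyMeasurable v (volume.restrict (Icc a b)))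
    (hM : ∀ s ∈ Icc a b, ‖v s‖ ≤ M) :
    ∫ t in Icc a b, inner ℝ (f t) (rlOp a b α v t) =
      ∫ s in Icc a b, inner ℝ (rlAdj a b α f s) (v s) := by
  have hP := integrableOn_prod_rlKernel_smul hab hα hα1 hf
  have hI : Integrable (fun p : ℝ × ℝ => inner ℝ (rlKernel α p.1 p.2 • f p.1) (v p.2))
      ((volume.restrict (Icc a b)).prod (volume.restrict (Icc a b))) := by
    refine (hP.norm.mul_const M).mono' (hP.1.inner hv.comp_snd) ?_
    have h1 : ∀ᵐ s ∂(volume.restrict (Icc a b)), ‖v s‖ ≤ M :=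
      ae_restrict_of_forall_mem measurableSet_Icc hM
    have h2 := (Measure.quasiMeasurePreserving_snd (μ := volume.restrict (Icc a b))
      (ν := volume.restrict (Icc a b))).ae h1
    filter_upwards [h2] with p hp
    exact (norm_inner_le_norm _ _).trans (mul_le_mul_of_nonneg_left hp (norm_nonneg _))
  have := integral_integral_swap (f := fun t s => inner ℝ (rlKernel α t s • f t) (v s)) hI
  have e1 : ∀ t, inner ℝ (f t) (rlOp a b α v t) =
      ∫ s in Icc a b, inner ℝ (rlKernel α t s • f t) (v s) := by
    intro t
    rw [rlOp, ← integral_inner (integrableOn_rlKernel_smul hα t hv hM)]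
    simp only [inner_smul_left, inner_smul_right, RCLike.conj_to_real]
  simp only [e1]
  rw [this]
  have h3 := hP.prod_left_ae
  refine integral_congr_ae ?_
  filter_upwards [h3] with s hs
  rw [rlAdj, real_inner_comm, ← integral_inner hs]
  simp only [real_inner_comm]

/-! ### Continuous representatives, absolute continuity, almost everywhere derivatives. -/

section ContRep

variable {F : Type*} [NormedAddCommGroup F] {a b : ℝ} {f G : ℝ → F}

/-- Continuous functions that agree almost everywhere on a nondegenerate interval agree everywhere
on it, so the choice made in `contRep` is irrelevant there. -/
theorem eqOn_contRep (hab : a < b) (hG : ContinuousOn G (Icc a b))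
    (h : G =ᵐ[volume.restrict (Icc a b)] f) : EqOn (contRep a b f) G (Icc a b) := by
  have hex : ∃ G : ℝ → F, ContinuousOn G (Icc a b) ∧ G =ᵐ[volume.restrict (Icc a b)] f := ⟨G, hG, h⟩
  rw [contRep, dif_pos hex]
  exact Measure.eqOn_Icc_of_ae_eq volume hab.ne (hex.choose_spec.2.trans h.symm)
    hex.choose_spec.1 hG

theorem contRep_ae_eq (a b : ℝ) (f : ℝ → F) : contRep a b f =ᵐ[volume.restrict (Icc a b)] f := by
  unfold contRep
  split_ifs with h
  exacts [h.choose_spec.2, EventuallyEq.rfl]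

theorem _root_.AbsolutelyContinuousOnInterval.congr {f G : ℝ → F}
    (hf : AbsolutelyContinuousOnInterval f a b)
    (h : EqOn f G (uIcc a b)) : AbsolutelyContinuousOnInterval G a b := by
  unfold AbsolutelyContinuousOnInterval at hf ⊢
  refine hf.congr' ?_
  refine eventually_inf_principal.2 (Eventually.of_forall fun I hI => ?_)
  refine Finset.sum_congr rfl fun i hi => ?_
  have := hI.1 i hi
  rw [h this.1, h this.2]

/-- Increments of the primitive of f are dominated by those of the primitive of ‖f‖, which reduces
to the scalar case. -/
theorem absolutelyContinuousOnInterval_integral [NormedSpace ℝ F] {c : ℝ}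
    (hf : IntervalIntegrable f volume a b) (hc : c ∈ uIcc a b) :
    AbsolutelyContinuousOnInterval (fun t => ∫ s in c..t, f s) a b := by
  have h := hf.norm.absolutelyContinuousOnInterval_intervalIntegral hc
  unfold AbsolutelyContinuousOnInterval at h ⊢
  refine squeeze_zero' (Eventually.of_forall fun _ => Finset.sum_nonneg fun _ _ => dist_nonneg)
    ?_ h
  refine eventually_inf_principal.2 (Eventually.of_forall fun I hI => ?_)
  refine Finset.sum_le_sum fun i hi => ?_
  obtain ⟨h1, h2⟩ := hI.1 i hi
  have hi' : ∀ x ∈ uIcc a b, IntervalIntegrable f volume c x := fun x hx =>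
    hf.mono_set (uIcc_subset_uIcc hc hx)
  rw [dist_comm, dist_eq_norm, dist_comm, Real.dist_eq, intervalIntegral.integral_interval_sub_left
    (hi' _ h2) (hi' _ h1), intervalIntegral.integral_interval_sub_left
    (hi' _ h2).norm (hi' _ h1).norm]
  exact intervalIntegral.norm_integral_le_abs_integral_norm

theorem ae_Icc_mem_Ioo (a b : ℝ) : ∀ᵐ t ∂(volume.restrict (Icc a b)), t ∈ Ioo a b := by
  rw [← Measure.restrict_congr_set (Ioo_ae_eq_Icc (μ := volume))]
  exact ae_restrict_mem measurableSet_Ioo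

theorem deriv_eq_of_eqOn_Icc [NormedSpace ℝ F] {f G : ℝ → F} (h : EqOn f G (Icc a b)) {t : ℝ}
    (ht : t ∈ Ioo a b) : deriv f t = deriv G t :=
  Filter.EventuallyEq.deriv_eq (by
    filter_upwards [Icc_mem_nhds ht.1 ht.2] with s hs using h hs)

theorem ae_hasDerivAt_integral_left [NormedSpace ℝ F] [CompleteSpace F] (hab : a ≤ b)
    (hf : IntegrableOn f (Icc a b)) :
    ∀ᵐ t ∂(volume.restrict (Icc a b)), HasDerivAt (fun t => ∫ s in a..t, f s) (f t) t := by
  have h := ((intervalIntegrable_iff_integrableOn_Icc_of_le hab).2 hf).ae_hasDerivAt_integral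
  rw [ae_restrict_iff' measurableSet_Icc]
  filter_upwards [h] with t ht hts
  exact ht (by rwa [uIcc_of_le hab]) a left_mem_uIcc

end ContRep

/-! ### Fractional derivatives of perturbed states and of fractional potentials. -/

section Derivatives

variable {E : Type*} [NormedAddCommGroup E] [NormedSpace ℝ E] {a b α : ℝ}

/-- `I^{1-α} I^α = I^1` on the left. -/
theorem leftRLIntegral_rlOp [CompleteSpace E] (hα : 0 < α) (hα1 : α ≤ 1) {f : ℝ → E}
    (hf : IntegrableOn f (Icc a b)) {r : ℝ} (hr : r ∈ Icc a b) :
    leftRLIntegral a (1 - α) (rlOp a b α f) r = ∫ s in a..r, f s := by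
  rcases hα1.lt_or_eq with h | rfl
  · rw [leftRLIntegral_eq_rlOp (sub_pos.2 h) hr, rlOp_comp hα h hf hr]
  · rw [leftRLIntegral, if_pos (sub_self _), ← leftRLIntegral_eq_rlOp hα hr, leftRLIntegral,
      if_neg one_ne_zero]
    simp

theorem leftRLIntegral_add_rlOp [CompleteSpace E] (hα : 0 < α) (hα1 : α ≤ 1) {y v : ℝ → E} {M : ℝ}
    (hy : ContinuousOn y (Icc a b)) (hv : AEStronglyMeasurable v (volume.restrict (Icc a b)))
    (hM : ∀ s ∈ Icc a b, ‖v s‖ ≤ M) {r : ℝ} (hr : r ∈ Icc a b) :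
    leftRLIntegral a (1 - α) (fun t => y t + rlOp a b α v t) r =
      leftRLIntegral a (1 - α) y r + ∫ s in a..r, v s := by
  have hvi : IntegrableOn v (Icc a b) :=
    Integrable.of_bound hv M (ae_restrict_of_forall_mem measurableSet_Icc hM)
  rw [← leftRLIntegral_rlOp hα hα1 hvi hr]
  rcases hα1.lt_or_eq with h | rfl
  · obtain ⟨C, hC⟩ := isCompact_Icc.exists_bound_of_continuousOn hy
    have hT := continuousOn_rlOp (a := a) (b := b) hα hα1 hv hM
    obtain ⟨C', hC'⟩ := isCompact_Icc.exists_bound_of_continuousOn hT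
    simp only [leftRLIntegral_eq_rlOp (sub_pos.2 h) hr]
    exact rlOp_add (sub_pos.2 h) (hy.aestronglyMeasurable measurableSet_Icc) hC
      (hT.aestronglyMeasurable measurableSet_Icc) hC' r
  · simp [leftRLIntegral]

/-- The fractional integral of order 1 - α of the perturbed increment differs from the original one
by the primitive of v. The constant c disappears because `rlOp` vanishes at a. -/
theorem CaputoACInf.add_rlOp [FiniteDimensional ℝ E] (hab : a < b) (hα : 0 < α)
    (hα1 : α ≤ 1) {x v : ℝ → E} (hx : x ∈ CaputoACInf a b α) (c : E) {M : ℝ}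
    (hv : AEStronglyMeasurable v (volume.restrict (Icc a b))) (hM : ∀ s ∈ Icc a b, ‖v s‖ ≤ M) :
    (fun t => x t + (c + rlOp a b α v t)) ∈ CaputoACInf a b α ∧
      caputoDeriv a b α (fun t => x t + (c + rlOp a b α v t)) =ᵐ[volume.restrict (Icc a b)]
        fun t => caputoDeriv a b α x t + v t := by
  have : CompleteSpace E := FiniteDimensional.complete ℝ E
  obtain ⟨hxc, ⟨hxi, hxac⟩, hxm⟩ := hx
  have hvi : IntegrableOn v (Icc a b) :=
    Integrable.of_bound hv M (ae_restrict_of_forall_mem measurableSet_Icc hM)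
  have hvI : IntervalIntegrable v volume a b :=
    (intervalIntegrable_iff_integrableOn_Icc_of_le hab.le).2 hvi
  have hT := continuousOn_rlOp (a := a) (b := b) hα hα1 hv hM
  have hz : (fun t => x t + (c + rlOp a b α v t) - (x a + (c + rlOp a b α v a))) =
      fun t => (x t - x a) + rlOp a b α v t := by
    funext t; rw [rlOp_left]; abel
  have hyc : ContinuousOn (fun t => x t - x a) (Icc a b) := hxc.sub continuousOn_const
  set P := contRep a b (leftRLIntegral a (1 - α) (fun t => x t - x a)) with hP
  have hVac := absolutelyContinuousOnInterval_integral hvI left_mem_uIcc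
  have hac := hxac.add hVac
  have hGc := hac.continuousOn
  rw [uIcc_of_le hab.le] at hGc
  have heq : EqOn (contRep a b (leftRLIntegral a (1 - α)
      (fun t => (x t - x a) + rlOp a b α v t))) (P + fun t => ∫ s in a..t, v s) (Icc a b) := by
    refine eqOn_contRep hab hGc ?_
    filter_upwards [contRep_ae_eq a b (leftRLIntegral a (1 - α) (fun t => x t - x a)),
      ae_restrict_mem measurableSet_Icc] with t ht htI
    rw [leftRLIntegral_add_rlOp hα hα1 hyc hv hM htI, Pi.add_apply, hP, ht]
  have hd : caputoDeriv a b α (fun t => x t + (c + rlOp a b α v t)) =ᵐ[volume.restrict (Icc a b)]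
        fun t => caputoDeriv a b α x t + v t := by
    unfold caputoDeriv leftRLDeriv
    rw [hz, ← hP]
    have hdiff : ∀ᵐ t ∂(volume.restrict (Icc a b)), DifferentiableAt ℝ P t := by
      rw [ae_restrict_iff' measurableSet_Icc, ← uIcc_of_le hab.le]
      exact hxac.boundedVariationOn.ae_differentiableAt_of_mem_uIcc
    filter_upwards [hdiff, ae_hasDerivAt_integral_left hab.le hvi, ae_Icc_mem_Ioo a b]
      with t h1 h2 h3
    rw [deriv_eq_of_eqOn_Icc heq h3, (h1.hasDerivAt.add h2).deriv]
  refine ⟨⟨hxc.add (continuousOn_const.add hT), ⟨?_, ?_⟩, ?_⟩, hd⟩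
  · rw [hz]
    exact (hyc.add hT).integrableOn_Icc
  · rw [hz]
    exact hac.congr (by rw [uIcc_of_le hab.le]; exact heq.symm)
  · rw [memLp_congr_ae hd]
    exact hxm.add (memLp_top_of_bound hv M (ae_restrict_of_forall_mem measurableSet_Icc hM))

/-- The right Riemann-Liouville derivative of a function with a known fractional potential. -/
theorem RightAC.of_ae_eq [CompleteSpace E] (hab : a < b) (hα : 0 < α) (hα1 : α ≤ 1) {q f : ℝ → E}
    (p : E) (hq : IntegrableOn q (Icc a b)) (hf : IntegrableOn f (Icc a b))
    (h : q =ᵐ[volume.restrict (Icc a b)] fun t => -rlAdj a b α f t - rlKernel α b t • p) :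
    RightAC a b α q ∧
    (∀ᵐ t ∂(volume.restrict (Icc a b)), rightRLDeriv a b α q t = -f t) ∧
    EqOn (contRep a b (rightRLIntegral b (1 - α) q)) (fun t => -(∫ s in t..b, f s) - p)
      (Icc a b) := by
  have hfI : IntervalIntegrable f volume a b :=
    (intervalIntegrable_iff_integrableOn_Icc_of_le hab.le).2 hf
  have hac : AbsolutelyContinuousOnInterval (fun t => -(∫ s in t..b, f s) - p) a b := by
    have h1 := absolutelyContinuousOnInterval_integral hfI right_mem_uIcc
    have h2 : AbsolutelyContinuousOnInterval (fun _ : ℝ => p) a b := by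
      refine LipschitzOnWith.absolutelyContinuousOnInterval (K := 0) ?_
      exact (LipschitzWith.const p).lipschitzOnWith
    refine (h1.sub h2).congr fun t _ => ?_
    simp only [Pi.sub_apply]
    rw [intervalIntegral.integral_symm t b]
  have hc := hac.continuousOn
  rw [uIcc_of_le hab.le] at hc
  have hae : (fun t => -(∫ s in t..b, f s) - p) =ᵐ[volume.restrict (Icc a b)]
      rightRLIntegral b (1 - α) q := by
    rcases hα1.lt_or_eq with h1 | rfl
    · filter_upwards [ae_Icc_mem_Ioo a b] with r hr
      have hrI := Ioo_subset_Icc_self hr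
      rw [rightRLIntegral_eq_rlAdj (sub_pos.2 h1) hrI]
      have e1 : rlAdj a b (1 - α) q r = ∫ t in Icc a b,
          (-(rlKernel (1 - α) t r • rlAdj a b α f t) -
            (rlKernel (1 - (1 - α)) b t * rlKernel (1 - α) t r) • p) := by
        refine integral_congr_ae ?_
        filter_upwards [h] with t ht
        rw [ht, sub_sub_cancel, smul_sub, smul_neg, smul_smul, mul_comm]
      have h0 : 1 - α < 1 := by linarith
      have hi2 := (integrable_rlKernel_mul (sub_pos.2 h1) h0 r b).1.integrableOn (s := Icc a b)
      -- As r < b, the beta integral equals 1: the singular term K(b,·) p contributes the constant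
      -- p. At r = b it would be 0, hence the restriction to the open interval.
      have e2 := setIntegral_rlKernel_mul (sub_pos.2 h1) h0 hrI (right_mem_Icc.2 hab.le)
      rw [if_pos hr.2] at e2
      obtain ⟨hi1, this⟩ := rlAdj_comp hα h1 hf hrI
      rw [e1, integral_sub (f := fun t => -(rlKernel (1 - α) t r • rlAdj a b α f t)) hi1.neg (hi2.smul_const p), integral_neg, integral_smul_const, e2,
        one_smul]
      rw [rlAdj] at this
      rw [this]
    · filter_upwards [h, ae_Icc_mem_Ioo a b] with r hr hrI
      rw [rightRLIntegral, if_pos (sub_self _), hr, rlKernel_of_lt hrI.2,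
        ← rightRLIntegral_eq_rlAdj hα (Ioo_subset_Icc_self hrI), rightRLIntegral,
        if_neg one_ne_zero]
      simp
  have heq := eqOn_contRep hab hc hae
  refine ⟨⟨hq, hac.congr (by rw [uIcc_of_le hab.le]; exact heq.symm)⟩, ?_, heq⟩
  filter_upwards [ae_hasDerivAt_integral_left hab.le hf, ae_Icc_mem_Ioo a b] with t ht hts
  rw [rightRLDeriv, deriv_eq_of_eqOn_Icc heq hts]
  -- Rewritten as a primitive from a, whose derivative is already known almost everywhere.
  have h2 : (fun t => -(∫ s in t..b, f s) - p) =ᶠ[𝓝 t]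
      fun t => (∫ s in a..t, f s) - ((∫ s in a..b, f s) + p) := by
    filter_upwards [Icc_mem_nhds hts.1 hts.2] with r hr
    have := intervalIntegral.integral_add_adjacent_intervals (μ := volume) (f := f) (a := a)
      (b := r) (c := b)
      (hfI.mono_set (uIcc_subset_uIcc left_mem_uIcc (by rwa [uIcc_of_le hab.le])))
      (hfI.mono_set (uIcc_subset_uIcc (by rwa [uIcc_of_le hab.le]) right_mem_uIcc))
    rw [← this]; abel
  rw [h2.deriv_eq, (ht.sub_const _).deriv]

end Derivatives

/-! ### Calculus of bounded measurable functions. -/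

section Bounded

variable {H : Type*} [NormedAddCommGroup H] [MeasurableSpace H] {a b : ℝ}

/-- Measurable functions that are bounded on `[a, b]`. -/
def BddMeas (a b : ℝ) (v : ℝ → H) : Prop :=
  Measurable v ∧ ∃ M, ∀ t ∈ Icc a b, ‖v t‖ ≤ M

theorem BddMeas.const (k : H) : BddMeas a b fun _ => k :=
  ⟨measurable_const, ‖k‖, fun _ _ => le_rfl⟩

theorem BddMeas.indicator {v : ℝ → H} (h : BddMeas a b v) {A : Set ℝ} (hA : MeasurableSet A) :
    BddMeas a b (A.indicator v) := by
  obtain ⟨hm, M, hM⟩ := h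
  exact ⟨hm.indicator hA, M, fun t ht => (norm_indicator_le_norm_self _ _).trans (hM t ht)⟩

theorem BddMeas.prodMk {H' : Type*} [NormedAddCommGroup H'] [MeasurableSpace H']
    {v : ℝ → H} {v' : ℝ → H'} (h : BddMeas a b v) (h' : BddMeas a b v') :
    BddMeas a b fun t => (v t, v' t) := by
  obtain ⟨hm, M, hM⟩ := h
  obtain ⟨hm', M', hM'⟩ := h'
  exact ⟨hm.prodMk hm', max M M', fun t ht => max_le_max (hM t ht) (hM' t ht)⟩

theorem BddMeas.integrableOn_mul {φ w : ℝ → ℝ} (h : BddMeas a b φ) (hw : IntegrableOn w (Icc a b)) :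
    IntegrableOn (fun t => w t * φ t) (Icc a b) := by
  obtain ⟨hm, M, hM⟩ := h
  exact hw.mul_bdd (c := M) hm.aestronglyMeasurable (ae_restrict_of_forall_mem measurableSet_Icc hM)

theorem BddMeas.mul {φ ψ : ℝ → ℝ} (h : BddMeas a b φ) (h' : BddMeas a b ψ) :
    BddMeas a b fun t => φ t * ψ t := by
  obtain ⟨hm, M, hM⟩ := h
  obtain ⟨hm', M', hM'⟩ := h'
  refine ⟨hm.mul hm', M * M', fun t ht => ?_⟩
  rw [norm_mul]
  exact mul_le_mul (hM t ht) (hM' t ht) (norm_nonneg _) ((norm_nonneg _).trans (hM t ht))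

variable [BorelSpace H]

theorem BddMeas.smul [NormedSpace ℝ H] {v : ℝ → H} (h : BddMeas a b v) (r : ℝ) :
    BddMeas a b fun t => r • v t := by
  obtain ⟨hm, M, hM⟩ := h
  refine ⟨hm.const_smul r, |r| * M, fun t ht => ?_⟩
  rw [norm_smul, Real.norm_eq_abs]
  exact mul_le_mul_of_nonneg_left (hM t ht) (abs_nonneg r)

theorem BddMeas.norm {v : ℝ → H} (h : BddMeas a b v) : BddMeas a b fun t => ‖v t‖ := by
  obtain ⟨hm, M, hM⟩ := h
  exact ⟨hm.norm, M, fun t ht => by simpa using hM t ht⟩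

/-- A continuous function of time and of a bounded measurable function is bounded measurable. -/
theorem BddMeas.comp_continuous [ProperSpace H] {H' : Type*} [NormedAddCommGroup H']
    [MeasurableSpace H'] [BorelSpace H'] {f : H × ℝ → H'} (hf : Continuous f) {p : ℝ → H}
    (hp : BddMeas a b p) : BddMeas a b fun t => f (p t, t) := by
  obtain ⟨hm, M, hM⟩ := hp
  obtain ⟨C, hC⟩ := ((isCompact_closedBall (0 : H) M).prod
    (isCompact_Icc (a := a) (b := b))).exists_bound_of_continuousOn hf.continuousOn
  refine ⟨hf.measurable.comp (hm.prodMk measurable_id), C, fun t ht => hC _ ⟨?_, ht⟩⟩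
  simpa using hM t ht

variable [SecondCountableTopology H]

theorem BddMeas.add {v v' : ℝ → H} (h : BddMeas a b v) (h' : BddMeas a b v') :
    BddMeas a b fun t => v t + v' t := by
  obtain ⟨hm, M, hM⟩ := h
  obtain ⟨hm', M', hM'⟩ := h'
  exact ⟨hm.add hm', M + M', fun t ht => norm_add_le_of_le (hM t ht) (hM' t ht)⟩

theorem BddMeas.rlOp [NormedSpace ℝ H] {α : ℝ} (hab : a ≤ b) (hα : 0 < α) (hα1 : α ≤ 1)
    {v : ℝ → H} (h : BddMeas a b v) : BddMeas a b (rlOp a b α v) := by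
  obtain ⟨hm, M, hM⟩ := h
  exact ⟨(measurable_rlOp hm.stronglyMeasurable).measurable, _,
    fun t _ => norm_rlOp_le hab hα hα1 hm.aestronglyMeasurable hM t⟩

end Bounded

/-! ### Expansion of integral functionals. -/

section Expansion

variable {V : Type*} [NormedAddCommGroup V] [NormedSpace ℝ V]

/-- `G` is the derivative of the integrand `L` in its first variable, jointly continuous and locally
Lipschitz in that variable, uniformly in time. -/
structure IsSmoothIntegrand (L : V → ℝ → ℝ) (G : V → ℝ → V →L[ℝ] ℝ) : Prop where
  continuous : Continuous fun z : V × ℝ => L z.1 z.2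
  continuous_deriv : Continuous fun z : V × ℝ => G z.1 z.2
  hasFDerivAt : ∀ p t, HasFDerivAt (fun p => L p t) (G p t) p
  lipschitz : ∀ M, ∃ C, 0 ≤ C ∧ ∀ t p p', ‖p‖ ≤ M → ‖p'‖ ≤ M → ‖G p t - G p' t‖ ≤ C * ‖p - p'‖

variable {L : V → ℝ → ℝ} {G : V → ℝ → V →L[ℝ] ℝ}

/-- Mean value inequality on the segment from p + d to p + d + q. The linear term is taken at p, not
at p + d, so the derivative error is of size ‖d‖ + ‖q‖: d need not be small, provided it is small on
average. -/
theorem IsSmoothIntegrand.expansion (hL : IsSmoothIntegrand L G) (M : ℝ) :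
    ∃ C, 0 ≤ C ∧ ∀ t p d q, ‖p‖ ≤ M → ‖d‖ ≤ M → ‖q‖ ≤ M →
      |L (p + d + q) t - L (p + d) t - G p t q| ≤ C * ((‖d‖ + ‖q‖) * ‖q‖) := by
  obtain ⟨C, hC0, hC⟩ := hL.lipschitz (M + M + M)
  refine ⟨C, hC0, fun t p d q hp hd hq => ?_⟩
  have hM : 0 ≤ M := (norm_nonneg p).trans hp
  have key := (convex_segment (p + d) (p + d + q)).norm_image_sub_le_of_norm_hasFDerivWithin_le'
    (f := fun p => L p t) (f' := fun p => G p t) (φ := G p t) (C := C * (‖d‖ + ‖q‖))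
    (x := p + d) (y := p + d + q)
    (fun z _ => (hL.hasFDerivAt z t).hasFDerivWithinAt) ?_ (left_mem_segment ℝ _ _)
    (right_mem_segment ℝ _ _)
  · simpa [mul_assoc] using key
  · intro z hz
    rw [segment_eq_image'] at hz
    obtain ⟨θ, ⟨h0, h1⟩, rfl⟩ := hz
    have hθ : ‖d + θ • q‖ ≤ ‖d‖ + ‖q‖ := by
      refine (norm_add_le _ _).trans (add_le_add le_rfl ?_)
      rw [norm_smul, Real.norm_of_nonneg h0]
      exact mul_le_of_le_one_left (norm_nonneg _) h1
    simp only [add_sub_cancel_left]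
    refine (hC t _ p ?_ (by linarith)).trans ?_
    · rw [add_assoc]
      exact (norm_add_le _ _).trans (by linarith)
    · rw [add_assoc, add_sub_cancel_left]
      exact mul_le_mul_of_nonneg_left hθ hC0

variable [FiniteDimensional ℝ V] [MeasurableSpace V] [BorelSpace V] {a b : ℝ}

theorem IsSmoothIntegrand.bddMeas (hL : IsSmoothIntegrand L G) {p : ℝ → V} (hp : BddMeas a b p) :
    BddMeas a b fun t => L (p t) t :=
  have := FiniteDimensional.proper_real V
  hp.comp_continuous hL.continuous

theorem IsSmoothIntegrand.bddMeas_deriv (hL : IsSmoothIntegrand L G) {p q : ℝ → V}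
    (hp : BddMeas a b p) (hq : BddMeas a b q) : BddMeas a b fun t => G (p t) t (q t) := by
  have := FiniteDimensional.proper_real V
  have hc : Continuous fun z : (V × V) × ℝ => G z.1.1 z.2 z.1.2 :=
    (hL.continuous_deriv.comp ((continuous_fst.comp continuous_fst).prodMk
      continuous_snd)).clm_apply (continuous_snd.comp continuous_fst)
  exact (hp.prodMk hq).comp_continuous hc

/-- Expansion of an integral functional at `p` along a large perturbation `d` and a small
perturbation `q`. -/
theorem IsSmoothIntegrand.integral_expansion (hL : IsSmoothIntegrand L G) {w : ℝ → ℝ}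
    (hw : IntegrableOn w (Icc a b)) (hw0 : ∀ t ∈ Icc a b, 0 ≤ w t) {p : ℝ → V}
    (hp : BddMeas a b p) (M : ℝ) :
    ∃ C, 0 ≤ C ∧ ∀ d q, BddMeas a b d → BddMeas a b q →
      (∀ t ∈ Icc a b, ‖d t‖ ≤ M) → (∀ t ∈ Icc a b, ‖q t‖ ≤ M) →
      ∫ t in Icc a b, w t * L (p t + d t + q t) t ≤ (∫ t in Icc a b, w t * L (p t) t) +
        (∫ t in Icc a b, w t * G (p t) t (d t + q t)) +
        (∫ t in Icc a b, w t * (L (p t + d t) t - L (p t) t - G (p t) t (d t))) +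
        C * ∫ t in Icc a b, w t * ((‖d t‖ + ‖q t‖) * ‖q t‖) := by
  have := FiniteDimensional.proper_real V
  obtain ⟨M', hM'⟩ := hp.2
  obtain ⟨C, hC0, hC⟩ := hL.expansion (max M M')
  refine ⟨C, hC0, fun d q hd hq hdM hqM => ?_⟩
  have i1 := (hL.bddMeas hp).integrableOn_mul hw
  have i2 := (hL.bddMeas_deriv hp (hd.add hq)).integrableOn_mul hw
  have e2 : BddMeas a b fun t => L (p t + d t) t - L (p t) t - G (p t) t (d t) := by
    have := ((hL.bddMeas (hp.add hd)).add ((hL.bddMeas hp).smul (-1))).add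
      ((hL.bddMeas_deriv hp hd).smul (-1))
    simpa [sub_eq_add_neg] using this
  have i3 := e2.integrableOn_mul hw
  have i4 := ((hd.norm.add hq.norm).mul hq.norm).integrableOn_mul hw
  have i5 := (hL.bddMeas ((hp.add hd).add hq)).integrableOn_mul hw
  have i12 : IntegrableOn (fun t => w t * L (p t) t + w t * G (p t) t (d t + q t)) (Icc a b) :=
    i1.add i2
  have i123 : IntegrableOn (fun t => w t * L (p t) t + w t * G (p t) t (d t + q t) +
    w t * (L (p t + d t) t - L (p t) t - G (p t) t (d t))) (Icc a b) := i12.add i3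
  rw [← integral_const_mul, ← integral_add i1 i2, ← integral_add i12 i3,
    ← integral_add i123 (i4.const_mul C)]
  refine setIntegral_mono_on i5 (i123.add (i4.const_mul C)) measurableSet_Icc
    fun t ht => ?_
  have h := (abs_le.1 (hC t (p t) (d t) (q t) ((hM' t ht).trans (le_max_right _ _))
    ((hdM t ht).trans (le_max_left _ _)) ((hqM t ht).trans (le_max_left _ _)))).2
  have h' := mul_le_mul_of_nonneg_left h (hw0 t ht)
  simp only [map_add]
  linarith

end Expansion

/-! ### Rectification of the constraint. -/

/-- A surjective differential lifts affine curves: near a point, `g` composed with a suitable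
local diffeomorphism tangent to the identity is affine. -/
theorem exists_rectification {Y Z : Type*} [NormedAddCommGroup Y] [NormedSpace ℝ Y]
    [CompleteSpace Y] [NormedAddCommGroup Z] [NormedSpace ℝ Z]
    {g : Y → Z} {y₀ : Y} {g' : Y →L[ℝ] Z} (hg : HasStrictFDerivAt g g' y₀)
    {R : Z →L[ℝ] Y} (hR : ∀ z, g' (R z) = z) :
    ∃ ρ : Y → Y, HasFDerivAt ρ (ContinuousLinearMap.id ℝ Y) 0 ∧ ρ 0 = 0 ∧
      ∀ᶠ y in 𝓝 0, g (y₀ + ρ y) = g y₀ + g' y := by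
  -- Ψ adds to y a lift by R of the nonlinear part of g, so g' ∘ Ψ recovers g(y₀ + y) - g(y₀)
  -- exactly while Ψ stays tangent to the identity. Its local inverse is ρ.
  set Ψ : Y → Y := fun y => y + R (g (y₀ + y) - g y₀ - g' y) with hΨ
  have h0 : HasStrictFDerivAt (fun y => g (y₀ + y)) g' 0 := by
    have h1 : HasStrictFDerivAt (fun y : Y => y₀ + y) (ContinuousLinearMap.id ℝ Y) 0 :=
      (hasStrictFDerivAt_id 0).const_add y₀
    have h2 : HasStrictFDerivAt g g' (y₀ + 0) := by rwa [add_zero]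
    simpa using h2.comp 0 h1
  have hΨd : HasStrictFDerivAt Ψ ((ContinuousLinearEquiv.refl ℝ Y : Y ≃L[ℝ] Y) : Y →L[ℝ] Y) 0 := by
    have h3 := (hasStrictFDerivAt_id (𝕜 := ℝ) (0 : Y)).add
      (R.hasStrictFDerivAt.comp 0 ((h0.sub_const (g y₀)).sub g'.hasStrictFDerivAt))
    refine h3.congr_fderiv ?_
    ext y
    simp
  have hΨ0 : Ψ 0 = 0 := by simp [hΨ]
  refine ⟨hΨd.localInverse Ψ _ 0, ?_, ?_, ?_⟩
  · have := hΨd.to_localInverse.hasFDerivAt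
    rw [hΨ0] at this
    exact this
  · have := hΨd.localInverse_apply_image
    rwa [hΨ0] at this
  · have := hΨd.eventually_right_inverse
    rw [hΨ0] at this
    filter_upwards [this] with y hy
    generalize hΨd.localInverse Ψ _ 0 y = z at hy ⊢
    have h5 := congrArg g' hy
    simp only [hΨ, map_add, hR] at h5
    rw [← h5]
    abel

theorem nonneg_of_le_mul_add_isLittleO {A : ℝ} {R : ℝ → ℝ} (hR : R =o[𝓝[>] 0] fun ε : ℝ => ε)
    (h : ∀ᶠ ε in 𝓝[>] (0 : ℝ), 0 ≤ ε * A + R ε) : 0 ≤ A := by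
  have h1 := hR.tendsto_div_nhds_zero
  have h2 : Tendsto (fun ε => A + R ε / ε) (𝓝[>] 0) (𝓝 (A + 0)) := tendsto_const_nhds.add h1
  rw [add_zero] at h2
  refine ge_of_tendsto h2 ?_
  filter_upwards [h, self_mem_nhdsWithin] with ε hε hpos
  have hpos' : 0 < ε := hpos
  have : A + R ε / ε = (ε * A + R ε) / ε := by field_simp
  rw [this]
  positivity

/-! ### Endpoint map, trajectories and first variation. -/

section Control

variable {E : Type*} [NormedAddCommGroup E] [NormedSpace ℝ E] {a b α : ℝ}

/-- Displacement of the endpoints under a perturbation `v` of the control and `c` of the initial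
value. -/
noncomputable def endpt (a b α : ℝ) (c : E) (v : ℝ → E) : E × E := (c, c + rlOp a b α v b)

/-- Displacement of the state and of the control. -/
noncomputable def traj (a b α : ℝ) (c : E) (v : ℝ → E) (t : ℝ) : E × E := (c + rlOp a b α v t, v t)

/-- First variation of the cost. -/
noncomputable def firstVar (a b α : ℝ) (w : ℝ → ℝ) (G : E × E → ℝ → E × E →L[ℝ] ℝ) (p : ℝ → E × E)
    (φ' : E × E →L[ℝ] ℝ) (c : E) (v : ℝ → E) : ℝ :=
  φ' (endpt a b α c v) + ∫ t in Icc a b, w t * G (p t) t (traj a b α c v t)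

/-- The constant control which, with the initial displacement `r.1`, displaces the endpoints
by `r`. -/
noncomputable def steer (a b α : ℝ) (r : E × E) : E :=
  ((b - a) ^ α / Real.Gamma (α + 1))⁻¹ • (r.2 - r.1)

theorem norm_steer_le (a b α : ℝ) (r : E × E) :
    ‖steer a b α r‖ ≤ |((b - a) ^ α / Real.Gamma (α + 1))⁻¹| * 2 * ‖r‖ := by
  rw [steer, norm_smul, Real.norm_eq_abs, mul_assoc]
  refine mul_le_mul_of_nonneg_left ?_ (abs_nonneg _)
  have := norm_sub_le r.2 r.1
  linarith [norm_fst_le r, norm_snd_le r]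

/-- A constant control k moves the final point by k (b-a)^α/Γ(α+1), which is inverted in `steer`. -/
theorem endpt_steer [CompleteSpace E] (hab : a < b) (hα : 0 < α) (r : E × E) :
    endpt a b α r.1 (fun _ => steer a b α r) = r := by
  have h1 : rlOp a b α (fun _ => (1 : ℝ)) b = (b - a) ^ α / Real.Gamma (α + 1) := by
    rw [← setIntegral_rlKernel hα (right_mem_Icc.2 hab.le)]
    simp [rlOp]
  have h2 : (b - a) ^ α / Real.Gamma (α + 1) ≠ 0 :=
    (div_pos (Real.rpow_pos_of_pos (sub_pos.2 hab) _)
      (Real.Gamma_pos_of_pos (by linarith))).ne'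
  rw [endpt, rlOp_const, h1, steer, smul_inv_smul₀ h2]
  simp

theorem endpt_smul (r : ℝ) (c : E) (v : ℝ → E) :
    endpt a b α (r • c) (fun t => r • v t) = r • endpt a b α c v := by
  rw [endpt, rlOp_smul, endpt, Prod.smul_mk, smul_add]

theorem traj_smul (r : ℝ) (c : E) (v : ℝ → E) (t : ℝ) :
    traj a b α (r • c) (fun t => r • v t) t = r • traj a b α c v t := by
  rw [traj, rlOp_smul, traj, Prod.smul_mk, smul_add]

variable {w : ℝ → ℝ} {L : E × E → ℝ → ℝ}
  {G : E × E → ℝ → E × E →L[ℝ] ℝ} {p : ℝ → E × E} {φ' : E × E →L[ℝ] ℝ}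

theorem firstVar_smul (r : ℝ) (c : E) (v : ℝ → E) :
    firstVar a b α w G p φ' (r • c) (fun t => r • v t) = r * firstVar a b α w G p φ' c v := by
  simp only [firstVar, endpt_smul, traj_smul, map_smul, smul_eq_mul, mul_left_comm _ r,
    integral_const_mul, mul_add]

variable [MeasurableSpace E]

theorem endpt_add (hα : 0 < α) [BorelSpace E] [SecondCountableTopology E] {v v' : ℝ → E}
    (hv : BddMeas a b v) (hv' : BddMeas a b v')
    (c c' : E) : endpt a b α (c + c') (fun t => v t + v' t) =
      endpt a b α c v + endpt a b α c' v' := by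
  obtain ⟨hm, M, hM⟩ := hv
  obtain ⟨hm', M', hM'⟩ := hv'
  rw [endpt, rlOp_add hα hm.aestronglyMeasurable hM hm'.aestronglyMeasurable hM', endpt, endpt,
    Prod.mk_add_mk]
  congr 1
  abel

theorem traj_add (hα : 0 < α) [BorelSpace E] [SecondCountableTopology E] {v v' : ℝ → E}
    (hv : BddMeas a b v) (hv' : BddMeas a b v')
    (c c' : E) (t : ℝ) : traj a b α (c + c') (fun t => v t + v' t) t =
      traj a b α c v t + traj a b α c' v' t := by
  obtain ⟨hm, M, hM⟩ := hv
  obtain ⟨hm', M', hM'⟩ := hv'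
  rw [traj, rlOp_add hα hm.aestronglyMeasurable hM hm'.aestronglyMeasurable hM', traj, traj,
    Prod.mk_add_mk]
  congr 1
  abel

variable [BorelSpace E]

theorem bddMeas_traj [SecondCountableTopology E] (hab : a ≤ b) (hα : 0 < α) (hα1 : α ≤ 1) (c : E)
    {v : ℝ → E} (hv : BddMeas a b v) : BddMeas a b (traj a b α c v) :=
  ((BddMeas.const c).add (hv.rlOp hab hα hα1)).prodMk hv

theorem norm_traj_le [SecondCountableTopology E] (hab : a ≤ b) (hα : 0 < α) (hα1 : α ≤ 1) (c : E)
    {v : ℝ → E} {M : ℝ} (hv : Measurable v) (hM : ∀ t ∈ Icc a b, ‖v t‖ ≤ M) {t : ℝ}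
    (ht : t ∈ Icc a b) :
    ‖traj a b α c v t‖ ≤ ‖c‖ + ((b - a) ^ α / Real.Gamma (α + 1) + 1) * M := by
  have h1 := norm_rlOp_le hab hα hα1 hv.aestronglyMeasurable hM t
  have h2 := hM t ht
  have hM0 : 0 ≤ M := (norm_nonneg _).trans h2
  have hG := (Real.Gamma_pos_of_pos (by linarith : 0 < α + 1)).le
  have hK : 0 ≤ (b - a) ^ α / Real.Gamma (α + 1) * M :=
    mul_nonneg (div_nonneg (Real.rpow_nonneg (sub_nonneg.2 hab) _) hG) hM0
  rw [traj, Prod.norm_def]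
  refine max_le ?_ ?_
  · refine (norm_add_le _ _).trans ?_
    linarith
  · have := norm_nonneg c
    simp only
    linarith

theorem exists_norm_traj_steer_le [SecondCountableTopology E] (hab : a ≤ b) (hα : 0 < α)
    (hα1 : α ≤ 1) : ∃ C, 0 ≤ C ∧ ∀ r : E × E, ∀ t ∈ Icc a b,
      ‖traj a b α r.1 (fun _ => steer a b α r) t‖ ≤ C * ‖r‖ := by
  have hK : 0 ≤ (b - a) ^ α / Real.Gamma (α + 1) :=
    div_nonneg (Real.rpow_nonneg (sub_nonneg.2 hab) _)
      (Real.Gamma_pos_of_pos (by linarith : 0 < α + 1)).le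
  refine ⟨1 + ((b - a) ^ α / Real.Gamma (α + 1) + 1) *
    (|((b - a) ^ α / Real.Gamma (α + 1))⁻¹| * 2), by positivity, fun r t ht => ?_⟩
  refine (norm_traj_le hab hα hα1 _ measurable_const
    (fun _ _ => norm_steer_le a b α r) ht).trans ?_
  have := norm_fst_le r
  linarith

variable [FiniteDimensional ℝ E]

theorem firstVar_add [SecondCountableTopology E] (hab : a ≤ b) (hα : 0 < α) (hα1 : α ≤ 1)
    (hL : IsSmoothIntegrand L G)
    (hw : IntegrableOn w (Icc a b)) (hp : BddMeas a b p) {v v' : ℝ → E}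
    (hv : BddMeas a b v) (hv' : BddMeas a b v') (c c' : E) :
    firstVar a b α w G p φ' (c + c') (fun t => v t + v' t) =
      firstVar a b α w G p φ' c v + firstVar a b α w G p φ' c' v' := by
  have h1 := (hL.bddMeas_deriv hp (bddMeas_traj hab hα hα1 c hv)).integrableOn_mul hw
  have h2 := (hL.bddMeas_deriv hp (bddMeas_traj hab hα hα1 c' hv')).integrableOn_mul hw
  simp only [firstVar, endpt_add hα hv hv', traj_add hα hv hv', map_add, mul_add]
  rw [integral_add h1 h2]
  ring

/-- The first variation along the steering controls, as a linear form on endpoint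
displacements. -/
noncomputable def steerVar [SecondCountableTopology E] (hab : a ≤ b) (hα : 0 < α) (hα1 : α ≤ 1)
    (hL : IsSmoothIntegrand L G) (hw : IntegrableOn w (Icc a b)) (hp : BddMeas a b p)
    (φ' : E × E →L[ℝ] ℝ) : E × E →L[ℝ] ℝ :=
  LinearMap.toContinuousLinearMap
    { toFun := fun r => firstVar a b α w G p φ' r.1 (fun _ => steer a b α r)
      map_add' := fun r r' => by
        rw [← firstVar_add hab hα hα1 hL hw hp (BddMeas.const _) (BddMeas.const _)]
        congr 1
        funext _
        simp only [steer, Prod.snd_add, Prod.fst_add, ← smul_add]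
        congr 1
        abel
      map_smul' := fun s r => by
        simp only [RingHom.id_apply, smul_eq_mul]
        rw [← firstVar_smul]
        congr 1
        funext _
        simp only [steer, Prod.smul_snd, Prod.smul_fst, ← smul_sub]
        rw [smul_comm] }

/-- Minimality of the process `p` with endpoints `y₀` among the processes obtained by perturbing
the initial value and the control, under the endpoint constraint `g ∈ S`. -/
def IsOptimal {Z : Type*} (a b α : ℝ) (w : ℝ → ℝ) (L : E × E → ℝ → ℝ) (p : ℝ → E × E)
    (φ : E × E → ℝ) (g : E × E → Z) (S : Set Z) (y₀ : E × E) : Prop :=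
  ∀ c v, BddMeas a b v → g (y₀ + endpt a b α c v) ∈ S →
    φ y₀ + ∫ t in Icc a b, w t * L (p t) t ≤
      φ (y₀ + endpt a b α c v) + ∫ t in Icc a b, w t * L (p t + traj a b α c v t) t

end Control

/-! ### First-order conditions and the multiplier. -/

section Necessary

variable {E Z : Type*} [NormedAddCommGroup E] [InnerProductSpace ℝ E] [FiniteDimensional ℝ E]
  [MeasurableSpace E] [BorelSpace E] [SecondCountableTopology E]
  {a b α : ℝ}
  {w : ℝ → ℝ} {L : E × E → ℝ → ℝ}
  {G : E × E → ℝ → E × E →L[ℝ] ℝ} {p : ℝ → E × E} {φ : E × E → ℝ} {φ' : E × E →L[ℝ] ℝ}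
  {g : E × E → Z} {S : Set Z} {y₀ : E × E}

/-- The control perturbation d is allowed to be large, and only its effect on the state joins the
small part. With d = 0 this serves smooth variations, with d a needle it serves the Weierstrass
condition. -/
theorem IsOptimal.expansion (h : IsOptimal a b α w L p φ g S y₀) (hab : a ≤ b) (hα : 0 < α)
    (hα1 : α ≤ 1) (hL : IsSmoothIntegrand L G) (hw : IntegrableOn w (Icc a b))
    (hw0 : ∀ t ∈ Icc a b, 0 ≤ w t) (hp : BddMeas a b p) (φ' : E × E →L[ℝ] ℝ) (M : ℝ) :
    ∃ C, 0 ≤ C ∧ ∀ (c : E) (v d : ℝ → E), BddMeas a b v → BddMeas a b d →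
      (∀ t ∈ Icc a b, ‖d t‖ ≤ M) →
      (∀ t ∈ Icc a b, ‖traj a b α c v t + (rlOp a b α d t, 0)‖ ≤ M) →
      g (y₀ + endpt a b α c (fun t => d t + v t)) ∈ S →
      0 ≤ firstVar a b α w G p φ' c (fun t => d t + v t) +
        (∫ t in Icc a b, w t * (L (p t + (0, d t)) t - L (p t) t - G (p t) t (0, d t))) +
        C * (∫ t in Icc a b, w t * ((‖d t‖ + ‖traj a b α c v t + (rlOp a b α d t, 0)‖) *
          ‖traj a b α c v t + (rlOp a b α d t, 0)‖)) +
        (φ (y₀ + endpt a b α c (fun t => d t + v t)) - φ y₀ -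
          φ' (endpt a b α c (fun t => d t + v t))) := by
  obtain ⟨C, hC0, hC⟩ := hL.integral_expansion hw hw0 hp M
  refine ⟨C, hC0, fun c v d hv hd hdM hqM hS => ?_⟩
  have h1 := h c _ (hd.add hv) hS
  have hD : BddMeas a b fun t => ((0 : E), d t) := (BddMeas.const 0).prodMk hd
  have hQ : BddMeas a b fun t => traj a b α c v t + (rlOp a b α d t, 0) :=
    (bddMeas_traj hab hα hα1 c hv).add ((hd.rlOp hab hα hα1).prodMk (BddMeas.const 0))
  have hn : ∀ t, ‖((0 : E), d t)‖ = ‖d t‖ := fun t => by simp [Prod.norm_def]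
  have h2 := hC _ _ hD hQ (fun t ht => (hn t).trans_le (hdM t ht)) hqM
  have e : ∀ t, traj a b α c (fun t => d t + v t) t =
      ((0 : E), d t) + (traj a b α c v t + (rlOp a b α d t, 0)) := by
    intro t
    have := traj_add (a := a) (b := b) hα hd hv 0 c t
    rw [zero_add] at this
    rw [this]
    simp [traj, add_comm, add_left_comm]
  simp only [e, ← add_assoc] at h1
  simp only [firstVar, e]
  simp only [hn] at h2
  simp only [add_assoc] at h1 h2 ⊢
  linarith

variable [NormedAddCommGroup Z] [InnerProductSpace ℝ Z] {g' : E × E →L[ℝ] Z}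

/-- The endpoint displacement is bent from ε y to ρ(ε y), where g is exactly affine, so convexity of
S keeps it feasible. The bending costs o(ε) and is realized by a steering control. -/
theorem IsOptimal.firstVar_nonneg (h : IsOptimal a b α w L p φ g S y₀) (hab : a < b) (hα : 0 < α)
    (hα1 : α ≤ 1) (hL : IsSmoothIntegrand L G) (hw : IntegrableOn w (Icc a b))
    (hw0 : ∀ t ∈ Icc a b, 0 ≤ w t) (hp : BddMeas a b p) (hφ : HasFDerivAt φ φ' y₀)
    {ρ : E × E → E × E} (hρ : HasFDerivAt ρ (ContinuousLinearMap.id ℝ (E × E)) 0) (hρ0 : ρ 0 = 0)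
    (hρg : ∀ᶠ y in 𝓝 0, g (y₀ + ρ y) = g y₀ + g' y) (hS : Convex ℝ S) (hy₀ : g y₀ ∈ S)
    {c : E} {v : ℝ → E} (hv : BddMeas a b v) (hcv : g y₀ + g' (endpt a b α c v) ∈ S) :
    0 ≤ firstVar a b α w G p φ' c v := by
  set y := endpt a b α c v with hy
  set r : ℝ → E × E := fun ε => ρ (ε • y) - ε • y with hr
  have hlin : Tendsto (fun ε : ℝ => ε • y) (𝓝[>] 0) (𝓝 0) := by
    have : Tendsto (fun ε : ℝ => ε • y) (𝓝 0) (𝓝 ((0 : ℝ) • y)) :=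
      (continuous_id.smul continuous_const).tendsto 0
    rw [zero_smul] at this
    exact this.mono_left nhdsWithin_le_nhds
  have hyO : (fun ε : ℝ => ε • y) =O[𝓝[>] 0] fun ε : ℝ => ε :=
    isBigO_of_le' (c := ‖y‖) _ fun ε => by rw [norm_smul, mul_comm]
  have hro : r =o[𝓝[>] 0] fun ε : ℝ => ε := by
    have h1 := (hasFDerivAt_iff_isLittleO_nhds_zero.1 hρ).comp_tendsto hlin
    refine IsLittleO.trans_isBigO ?_ hyO
    refine h1.congr_left fun ε => ?_
    simp [hr, hρ0]
  have hρO : (fun ε => ρ (ε • y)) =O[𝓝[>] 0] fun ε : ℝ => ε := by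
    refine (hro.isBigO.add hyO).congr_left fun ε => ?_
    simp [hr]
  have hid : Tendsto (fun ε : ℝ => ε) (𝓝[>] 0) (𝓝 0) := tendsto_id.mono_left nhdsWithin_le_nhds
  have hφo : (fun ε => φ (y₀ + ρ (ε • y)) - φ y₀ - φ' (ρ (ε • y))) =o[𝓝[>] 0] fun ε : ℝ => ε :=
    ((hasFDerivAt_iff_isLittleO_nhds_zero.1 hφ).comp_tendsto
      (hρO.trans_tendsto hid)).trans_isBigO hρO
  set Λ := steerVar (φ' := φ') hab.le hα hα1 hL hw hp with hΛ
  obtain ⟨C₁, hC₁0, hC₁⟩ := exists_norm_traj_steer_le (E := E) hab.le hα hα1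
  obtain ⟨M, hM⟩ := (bddMeas_traj hab.le hα hα1 c hv).2
  have hM0 : 0 ≤ M := (norm_nonneg _).trans (hM a (left_mem_Icc.2 hab.le))
  obtain ⟨C, hC0, hC⟩ := h.expansion hab.le hα hα1 hL hw hw0 hp φ' 1
  -- Uniform bound for the displacement of state and control: the scaled direction plus the steering
  -- correction.
  set s : ℝ → ℝ := fun ε => |ε| * M + C₁ * ‖r ε‖ with hs
  have hsO : s =O[𝓝[>] 0] fun ε : ℝ => ε := by
    have h1 : (fun ε : ℝ => |ε| * M) =O[𝓝[>] 0] fun ε : ℝ => ε :=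
      isBigO_of_le' (c := M) _ fun ε => by
        rw [norm_mul, Real.norm_of_nonneg hM0, norm_abs_eq_norm, mul_comm]
    exact h1.add (hro.isBigO.norm_left.const_mul_left C₁)
  have hs0 : Tendsto s (𝓝[>] 0) (𝓝 0) := hsO.trans_tendsto hid
  have hsq : (fun ε => s ε * s ε) =o[𝓝[>] 0] fun ε : ℝ => ε := by
    have h1 : s =o[𝓝[>] 0] fun _ : ℝ => (1 : ℝ) := (isLittleO_one_iff ℝ).2 hs0
    simpa using h1.mul_isBigO hsO
  have hR : (fun ε => Λ (r ε) + C * ((∫ t in Icc a b, w t) * (s ε * s ε)) +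
      (φ (y₀ + ρ (ε • y)) - φ y₀ - φ' (ρ (ε • y)))) =o[𝓝[>] 0] fun ε : ℝ => ε :=
    (((Λ.isBigO_comp r _).trans_isLittleO hro).add
      ((hsq.const_mul_left _).const_mul_left _)).add hφo
  refine nonneg_of_le_mul_add_isLittleO hR ?_
  have hev1 : ∀ᶠ ε in 𝓝[>] (0 : ℝ), s ε ≤ 1 := by
    filter_upwards [hs0.eventually (gt_mem_nhds one_pos)] with ε hε using hε.le
  filter_upwards [hev1, hlin.eventually hρg, Ioo_mem_nhdsGT (one_pos : (0 : ℝ) < 1)]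
    with ε hε1 hεg hε
  set k := steer a b α (r ε) with hk
  set V : ℝ → E := fun t => ε • v t + k with hV
  have hVb : BddMeas a b V := (hv.smul ε).add (BddMeas.const k)
  have hend : endpt a b α (ε • c + (r ε).1) V = ρ (ε • y) := by
    rw [hV, endpt_add hα (hv.smul ε) (BddMeas.const k), endpt_smul, hk, endpt_steer hab hα, ← hy]
    simp [hr]
  have htraj : ∀ t ∈ Icc a b, ‖traj a b α (ε • c + (r ε).1) V t‖ ≤ s ε := by
    intro t ht
    rw [hV, traj_add hα (hv.smul ε) (BddMeas.const k), traj_smul]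
    refine norm_add_le_of_le ?_ (hC₁ _ t ht)
    rw [norm_smul, Real.norm_eq_abs]
    exact mul_le_mul_of_nonneg_left (hM t ht) (abs_nonneg _)
  have hz : ∀ t, rlOp a b α (fun _ => (0 : E)) t = 0 := fun t => by simp [rlOp]
  have key := hC (ε • c + (r ε).1) V (fun _ => 0) hVb (BddMeas.const 0) (by simp)
    (fun t ht => by
      rw [hz, show ((0 : E), (0 : E)) = 0 from rfl, add_zero]
      exact (htraj t ht).trans hε1)
    (by
      simp only [zero_add]
      rw [hend, hεg, map_smul]
      -- The value g(y₀) + ε g'(y) is the convex combination of g(y₀) and g(y₀) + g'(y) with weight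
      -- ε < 1.
      have h2 := hS hy₀ hcv (by linarith [hε.2] : 0 ≤ 1 - ε) hε.1.le (by ring)
      convert h2 using 1
      rw [smul_add, ← add_assoc, ← add_smul]
      simp)
  have hfv : firstVar a b α w G p φ' (ε • c + (r ε).1) V =
      ε * firstVar a b α w G p φ' c v + Λ (r ε) := by
    rw [hV, firstVar_add hab.le hα hα1 hL hw hp (hv.smul ε) (BddMeas.const k), firstVar_smul]
    rfl
  simp only [zero_add, hend, hfv, hz] at key
  have hz2 : ((0 : E), (0 : E)) = 0 := rfl
  simp only [hz2, add_zero, norm_zero, zero_add, map_zero, sub_self, mul_zero, integral_zero] at key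
  have hint : ∫ t in Icc a b, w t * (‖traj a b α (ε • c + (r ε).1) V t‖ *
      ‖traj a b α (ε • c + (r ε).1) V t‖) ≤ (∫ t in Icc a b, w t) * (s ε * s ε) := by
    rw [← integral_mul_const]
    have hb := (bddMeas_traj hab.le hα hα1 (ε • c + (r ε).1) hVb).norm
    refine setIntegral_mono_on ((hb.mul hb).integrableOn_mul hw) (hw.mul_const _)
      measurableSet_Icc fun t ht => ?_
    exact mul_le_mul_of_nonneg_left (mul_self_le_mul_self (norm_nonneg _) (htraj t ht)) (hw0 t ht)
  have := mul_le_mul_of_nonneg_left hint hC0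
  linarith

variable [FiniteDimensional ℝ Z]

/-- Lagrange multiplier rule. -/
theorem IsOptimal.exists_multiplier (h : IsOptimal a b α w L p φ g S y₀) (hab : a < b)
    (hα : 0 < α) (hα1 : α ≤ 1) (hL : IsSmoothIntegrand L G) (hw : IntegrableOn w (Icc a b))
    (hw0 : ∀ t ∈ Icc a b, 0 ≤ w t) (hp : BddMeas a b p) (hφ : HasFDerivAt φ φ' y₀)
    {ρ : E × E → E × E} (hρ : HasFDerivAt ρ (ContinuousLinearMap.id ℝ (E × E)) 0) (hρ0 : ρ 0 = 0)
    (hρg : ∀ᶠ y in 𝓝 0, g (y₀ + ρ y) = g y₀ + g' y) (hS : Convex ℝ S) (hy₀ : g y₀ ∈ S)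
    {R : Z →L[ℝ] E × E} (hR : ∀ z, g' (R z) = z) :
    ∃ ψ : Z, (∀ z ∈ S, 0 ≤ inner ℝ ψ (z - g y₀)) ∧ ∀ c v, BddMeas a b v →
      firstVar a b α w G p φ' c v = inner ℝ ψ (g' (endpt a b α c v)) := by
  have hpos := fun (c : E) (v : ℝ → E) (hv : BddMeas a b v)
    (hcv : g y₀ + g' (endpt a b α c v) ∈ S) =>
    h.firstVar_nonneg hab hα hα1 hL hw hw0 hp hφ hρ hρ0 hρg hS hy₀ hv hcv
  set Λ := steerVar (φ' := φ') hab.le hα hα1 hL hw hp with hΛ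
  -- When g' kills the endpoint displacement, (c, v) and its opposite are both admissible.
  have hker : ∀ c v, BddMeas a b v → g' (endpt a b α c v) = 0 →
      firstVar a b α w G p φ' c v = 0 := by
    intro c v hv h0
    refine le_antisymm ?_ (hpos c v hv (by rwa [h0, add_zero]))
    have h1 := hpos ((-1 : ℝ) • c) (fun t => (-1 : ℝ) • v t) (hv.smul (-1))
      (by rw [endpt_smul, map_smul, h0, smul_zero, add_zero]; exact hy₀)
    rw [firstVar_smul] at h1
    linarith
  -- Subtracting the steering control that realizes R g'(endpoint) lands in the kernel case, so the
  -- first variation depends on the endpoints only through g'.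
  have hfv : ∀ c v, BddMeas a b v →
      firstVar a b α w G p φ' c v = Λ (R (g' (endpt a b α c v))) := by
    intro c v hv
    set r := R (g' (endpt a b α c v)) with hr
    have h1 : BddMeas a b fun _ : ℝ => (-1 : ℝ) • steer a b α r := BddMeas.const _
    have h2 := hker (c + (-1 : ℝ) • r.1) (fun t => v t + (-1 : ℝ) • steer a b α r) (hv.add h1) (by
      rw [endpt_add hα hv h1, endpt_smul, endpt_steer hab hα, map_add, map_smul, hr, hR]
      simp)
    rw [firstVar_add hab.le hα hα1 hL hw hp hv h1, firstVar_smul] at h2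
    have h3 : Λ r = firstVar a b α w G p φ' r.1 (fun _ => steer a b α r) := rfl
    rw [h3]
    linarith
  refine ⟨(InnerProductSpace.toDual ℝ Z).symm (Λ.comp R), fun z hz => ?_, fun c v hv => ?_⟩
  · rw [InnerProductSpace.toDual_symm_apply]
    -- Steering by R (z - g y₀) makes the linearized constraint value equal to z ∈ S.
    have h1 := hpos (R (z - g y₀)).1 (fun _ => steer a b α (R (z - g y₀))) (BddMeas.const _) (by
      rw [endpt_steer hab hα, hR]
      simpa using hz)
    exact h1
  · rw [InnerProductSpace.toDual_symm_apply, hfv c v hv]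
    rfl

end Necessary

/-! ### Needle variations and the Weierstrass condition. -/

section Needle

variable {a b α : ℝ}

/-- The Lebesgue point property at τ, in the one-sided form used for needles on [τ, τ + ε]. -/
theorem isLittleO_setIntegral_Icc {f : ℝ → ℝ} (hf : IntegrableOn f (Icc a b)) {τ : ℝ}
    (hτ : τ ∈ Ioo a b) (hd : HasDerivAt (fun t => ∫ s in a..t, f s) (f τ) τ) :
    (fun ε => (∫ s in Icc τ (τ + ε), f s) - ε * f τ) =o[𝓝[>] 0] fun ε : ℝ => ε := by
  have h1 := (hasDerivAt_iff_isLittleO_nhds_zero.1 hd).mono (nhdsWithin_le_nhds (s := Ioi 0))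
  refine h1.congr' ?_ EventuallyEq.rfl
  filter_upwards [Ioo_mem_nhdsGT (sub_pos.2 hτ.2)] with ε hε
  have hi : ∀ c d, c ∈ Icc a b → d ∈ Icc a b → IntervalIntegrable f volume c d := fun c d hc hd =>
    ((hf.mono_set (uIcc_subset_Icc hc hd))).intervalIntegrable
  have hab : a ≤ b := (hτ.1.trans hτ.2).le
  have hτI := Ioo_subset_Icc_self hτ
  have hτε : τ + ε ∈ Icc a b := ⟨by linarith [hτ.1, hε.1], by linarith [hε.2]⟩
  rw [intervalIntegral.integral_interval_sub_left (hi _ _ (left_mem_Icc.2 hab) hτε)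
    (hi _ _ (left_mem_Icc.2 hab) hτI), intervalIntegral.integral_of_le (by linarith [hε.1]),
    integral_Icc_eq_integral_Ioc, smul_eq_mul]

theorem isBigO_setIntegral_Icc {f : ℝ → ℝ} (hf : IntegrableOn f (Icc a b)) {τ : ℝ}
    (hτ : τ ∈ Ioo a b) (hd : HasDerivAt (fun t => ∫ s in a..t, f s) (f τ) τ) :
    (fun ε => ∫ s in Icc τ (τ + ε), f s) =O[𝓝[>] 0] fun ε : ℝ => ε := by
  have h1 := (isLittleO_setIntegral_Icc hf hτ hd).isBigO
  have h2 : (fun ε : ℝ => ε * f τ) =O[𝓝[>] 0] fun ε : ℝ => ε := by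
    simpa [mul_comm] using (isBigO_refl (fun ε : ℝ => ε) (𝓝[>] 0)).const_mul_left (f τ)
  exact (h1.add h2).congr_left fun ε => by ring

variable {E Z : Type*} [NormedAddCommGroup E] [InnerProductSpace ℝ E] [FiniteDimensional ℝ E]
  [MeasurableSpace E] [BorelSpace E] [SecondCountableTopology E]
  [NormedAddCommGroup Z] [InnerProductSpace ℝ Z]
  {w : ℝ → ℝ} {L : E × E → ℝ → ℝ}
  {G : E × E → ℝ → E × E →L[ℝ] ℝ} {p : ℝ → E × E} {φ : E × E → ℝ} {φ' : E × E →L[ℝ] ℝ}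
  {g : E × E → Z} {g' : E × E →L[ℝ] Z} {S : Set Z} {y₀ : E × E}

/-- Weierstrass condition along a fixed direction, by needle variations. -/
theorem IsOptimal.ae_excess_nonneg (h : IsOptimal a b α w L p φ g S y₀) (hab : a < b)
    (hα : 0 < α) (hα1 : α ≤ 1) (hL : IsSmoothIntegrand L G) (hw : IntegrableOn w (Icc a b))
    (hw0 : ∀ t ∈ Icc a b, 0 ≤ w t) (hp : BddMeas a b p) (hφ : HasFDerivAt φ φ' y₀)
    {ρ : E × E → E × E} (hρ : HasFDerivAt ρ (ContinuousLinearMap.id ℝ (E × E)) 0) (hρ0 : ρ 0 = 0)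
    (hρg : ∀ᶠ y in 𝓝 0, g (y₀ + ρ y) = g y₀ + g' y) (hy₀ : g y₀ ∈ S)
    {R : Z →L[ℝ] E × E} (hR : ∀ z, g' (R z) = z) {ψ : Z}
    (hψ : ∀ c v, BddMeas a b v →
      firstVar a b α w G p φ' c v = inner ℝ ψ (g' (endpt a b α c v))) (v₀ : E) :
    ∀ᵐ τ ∂(volume.restrict (Icc a b)),
      0 ≤ w τ * (L (p τ + (0, v₀)) τ - L (p τ) τ - G (p τ) τ (0, v₀)) := by
  have hc0 : BddMeas a b fun _ : ℝ => ((0 : E), v₀) := BddMeas.const _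
  set X : ℝ → ℝ := fun t => w t * (L (p t + (0, v₀)) t - L (p t) t - G (p t) t (0, v₀)) with hX
  have hXi : IntegrableOn X (Icc a b) := by
    have h1 := ((hL.bddMeas (hp.add hc0)).add ((hL.bddMeas hp).smul (-1))).add
      ((hL.bddMeas_deriv hp hc0).smul (-1))
    refine BddMeas.integrableOn_mul ?_ hw
    simpa [sub_eq_add_neg] using h1
  have hAi := integrableOn_rlAdj hab.le hα hα1 hw
  have hKi := integrableOn_rlKernel hα b a b
  filter_upwards [ae_Icc_mem_Ioo a b, ae_hasDerivAt_integral_left hab.le hXi,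
    ae_hasDerivAt_integral_left hab.le hw, ae_hasDerivAt_integral_left hab.le hAi,
    ae_hasDerivAt_integral_left hab.le hKi] with τ hτ hdX hdw hdA hdK
  have hXo := isLittleO_setIntegral_Icc hXi hτ hdX
  have hwO := isBigO_setIntegral_Icc hw hτ hdw
  have hAO := isBigO_setIntegral_Icc hAi hτ hdA
  have hKO := isBigO_setIntegral_Icc hKi hτ hdK
  have hid : Tendsto (fun ε : ℝ => ε) (𝓝[>] 0) (𝓝 0) := tendsto_id.mono_left nhdsWithin_le_nhds
  -- the needle and the endpoint displacement it causes
  set χ : ℝ → ℝ → ℝ := fun ε => (Icc τ (τ + ε)).indicator (fun _ => (1 : ℝ)) with hχ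
  have hχb : ∀ ε, BddMeas a b (χ ε) := fun ε => (BddMeas.const 1).indicator measurableSet_Icc
  set σ : ℝ → ℝ → ℝ := fun ε => rlOp a b α (χ ε) with hσ
  set d : ℝ → ℝ → E := fun ε t => χ ε t • v₀ with hd
  have hdb : ∀ ε, BddMeas a b (d ε) := by
    intro ε
    have : BddMeas a b ((Icc τ (τ + ε)).indicator fun _ => v₀) :=
      (BddMeas.const v₀).indicator measurableSet_Icc
    refine (congrArg (BddMeas a b) ?_).mp this
    funext t
    by_cases ht : t ∈ Icc τ (τ + ε) <;> simp [hd, hχ, ht]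
  have hdop : ∀ ε t, rlOp a b α (d ε) t = σ ε t • v₀ := by
    intro ε t
    simp only [hd, hσ, rlOp, smul_eq_mul, ← smul_assoc, integral_smul_const]
  have hχ0 : ∀ ε t, 0 ≤ χ ε t := fun ε t => indicator_nonneg (fun _ _ => zero_le_one) _
  have hσ0 : ∀ ε t, 0 ≤ σ ε t := fun ε t =>
    integral_nonneg fun s => mul_nonneg (rlKernel_nonneg hα t s) (hχ0 ε s)
  have hsub : ∀ ε ∈ Ioo 0 (b - τ), Icc τ (τ + ε) ⊆ Icc a b := fun ε hε =>
    Icc_subset_Icc hτ.1.le (by linarith [hε.2])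
  have hmulχ : ∀ ε ∈ Ioo 0 (b - τ), ∀ f : ℝ → ℝ,
      ∫ t in Icc a b, f t * χ ε t = ∫ t in Icc τ (τ + ε), f t := by
    intro ε hε f
    have : ∀ t, f t * χ ε t = (Icc τ (τ + ε)).indicator f t := fun t => by
      by_cases ht : t ∈ Icc τ (τ + ε) <;> simp [hχ, ht]
    simp only [this]
    rw [setIntegral_indicator measurableSet_Icc, inter_eq_right.2 (hsub ε hε)]
  have hσeq : ∀ ε ∈ Ioo 0 (b - τ), ∀ t, σ ε t = ∫ s in Icc τ (τ + ε), rlKernel α t s :=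
    fun ε hε t => hmulχ ε hε (rlKernel α t)
  have hσle : ∀ ε ∈ Ioo 0 (b - τ), ∀ t, σ ε t ≤ ε ^ α / Real.Gamma (α + 1) := by
    intro ε hε t
    rw [hσeq ε hε]
    refine (setIntegral_rlKernel_Icc_le hα hα1 (by linarith [hε.1]) t).trans_eq ?_
    rw [add_sub_cancel_left]
  -- Transposing the operator moves the whole trajectory back onto the needle, so the weighted mean
  -- of the state displacement is O(ε) although its supremum may only be O(ε^α).
  have hwσ : ∀ ε ∈ Ioo 0 (b - τ),
      ∫ t in Icc a b, w t * σ ε t = ∫ t in Icc τ (τ + ε), rlAdj a b α w t := by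
    intro ε hε
    have h1 := integral_inner_rlOp hab.le hα hα1 hw (hχb ε).1.aestronglyMeasurable
      (hχb ε).2.choose_spec
    simp only [RCLike.inner_apply, conj_trivial] at h1
    rw [← hmulχ ε hε]
    simpa [mul_comm] using h1
  have hI : ∀ᶠ ε in 𝓝[>] (0 : ℝ), ε ∈ Ioo 0 (b - τ) := Ioo_mem_nhdsGT (sub_pos.2 hτ.2)
  set e : ℝ → E × E := fun ε => endpt a b α 0 (d ε) with he
  have heO : e =O[𝓝[>] 0] fun ε : ℝ => ε := by
    refine IsBigO.trans ?_ hKO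
    refine IsBigO.of_bound ‖v₀‖ ?_
    filter_upwards [hI] with ε hε
    rw [← hσeq ε hε, Real.norm_of_nonneg (hσ0 _ _)]
    simp only [he, endpt, zero_add, Prod.norm_mk, norm_zero, hdop]
    rw [max_eq_right (norm_nonneg _), norm_smul, Real.norm_of_nonneg (hσ0 _ _), mul_comm]
  -- Projection of the needle's endpoint displacement onto ker g' along the range of R: the
  -- corrected endpoints keep g equal to g(y₀), so only g(y₀) ∈ S is needed.
  set y : ℝ → E × E := fun ε => e ε - R (g' (e ε)) with hy
  have hyO : y =O[𝓝[>] 0] fun ε : ℝ => ε :=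
    heO.sub (((R.comp g').isBigO_comp e _).trans heO)
  have hy0 : Tendsto y (𝓝[>] 0) (𝓝 0) := hyO.trans_tendsto hid
  have hgy : ∀ ε, g' (y ε) = 0 := fun ε => by simp [hy, hR]
  have hρo : (fun ε => ρ (y ε) - y ε) =o[𝓝[>] 0] fun ε : ℝ => ε := by
    have h1 := (hasFDerivAt_iff_isLittleO_nhds_zero.1 hρ).comp_tendsto hy0
    refine IsLittleO.trans_isBigO ?_ hyO
    refine h1.congr_left fun ε => ?_
    simp [hρ0]
  have hρO : (fun ε => ρ (y ε)) =O[𝓝[>] 0] fun ε : ℝ => ε :=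
    (hρo.isBigO.add hyO).congr_left fun ε => by simp
  -- The displacement left to the steering control. It is only O(ε), but enters the remainder
  -- through a quadratic term.
  set r : ℝ → E × E := fun ε => ρ (y ε) - e ε with hr
  have hrO : r =O[𝓝[>] 0] fun ε : ℝ => ε := hρO.sub heO
  have hφo : (fun ε => φ (y₀ + ρ (y ε)) - φ y₀ - φ' (ρ (y ε))) =o[𝓝[>] 0] fun ε : ℝ => ε :=
    ((hasFDerivAt_iff_isLittleO_nhds_zero.1 hφ).comp_tendsto
      (hρO.trans_tendsto hid)).trans_isBigO hρO
  obtain ⟨C₁, hC₁0, hC₁⟩ := exists_norm_traj_steer_le (E := E) hab.le hα hα1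
  obtain ⟨C, hC0, hC⟩ := h.expansion hab.le hα hα1 hL hw hw0 hp φ' (max 1 ‖v₀‖)
  -- uniform and integral bounds for the displacement of the state
  set η : ℝ → ℝ := fun ε => C₁ * ‖r ε‖ + ε ^ α / Real.Gamma (α + 1) * ‖v₀‖ with hη
  have hη0 : Tendsto η (𝓝[>] 0) (𝓝 0) := by
    have h1 : Tendsto (fun ε => C₁ * ‖r ε‖) (𝓝[>] 0) (𝓝 (C₁ * 0)) :=
      (hrO.norm_left.trans_tendsto hid).const_mul C₁
    have h2 : Tendsto (fun ε : ℝ => ε ^ α) (𝓝[>] 0) (𝓝 ((0 : ℝ) ^ α)) :=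
      ((Real.continuousAt_rpow_const 0 α (Or.inr hα.le)).tendsto).mono_left nhdsWithin_le_nhds
    rw [Real.zero_rpow hα.ne'] at h2
    have h3 := h1.add ((h2.div_const (Real.Gamma (α + 1))).mul_const ‖v₀‖)
    simpa using h3
  set B : ℝ → ℝ := fun ε => ‖v₀‖ * (∫ t in Icc τ (τ + ε), w t) +
    (C₁ * ‖r ε‖ * (∫ t in Icc a b, w t) + ‖v₀‖ * ∫ t in Icc τ (τ + ε), rlAdj a b α w t) with hB
  have hBO : B =O[𝓝[>] 0] fun ε : ℝ => ε := by
    refine (hwO.const_mul_left _).add (IsBigO.add ?_ (hAO.const_mul_left _))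
    refine ((hrO.norm_left.const_mul_left (C₁ * ∫ t in Icc a b, w t))).congr_left fun ε => ?_
    ring
  have hηB : (fun ε => B ε * η ε) =o[𝓝[>] 0] fun ε : ℝ => ε := by
    have h1 : η =o[𝓝[>] 0] fun _ : ℝ => (1 : ℝ) := (isLittleO_one_iff ℝ).2 hη0
    simpa using hBO.mul_isLittleO h1
  have hRo : (fun ε => inner ℝ ψ (g' (ρ (y ε) - y ε)) +
      ((∫ s in Icc τ (τ + ε), X s) - ε * X τ) + C * (B ε * η ε) +
      (φ (y₀ + ρ (y ε)) - φ y₀ - φ' (ρ (y ε)))) =o[𝓝[>] 0] fun ε : ℝ => ε := by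
    refine (((IsLittleO.add ?_ hXo).add (hηB.const_mul_left C))).add hφo
    exact ((((innerSL ℝ ψ).comp g').isBigO_comp (fun ε => ρ (y ε) - y ε) _).trans_isLittleO hρo)
  refine nonneg_of_le_mul_add_isLittleO hRo ?_
  filter_upwards [hI, hη0.eventually (gt_mem_nhds one_pos), hy0.eventually hρg] with ε hε hη1 hgε
  set k := steer a b α (r ε) with hk
  have hkb : BddMeas a b fun _ : ℝ => k := BddMeas.const k
  have hend : endpt a b α (r ε).1 (fun t => d ε t + k) = ρ (y ε) := by
    have h1 := endpt_add hα (hdb ε) hkb 0 (r ε).1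
    rw [zero_add] at h1
    rw [h1, hk, endpt_steer hab hα]
    simp [hr, he]
  have hq : ∀ t ∈ Icc a b, ‖traj a b α (r ε).1 (fun _ => k) t + (rlOp a b α (d ε) t, 0)‖ ≤
      C₁ * ‖r ε‖ + ‖v₀‖ * σ ε t := by
    intro t ht
    refine norm_add_le_of_le (hC₁ _ t ht) ?_
    simp only [Prod.norm_mk, norm_zero, hdop]
    rw [max_eq_left (norm_nonneg _), norm_smul, Real.norm_of_nonneg (hσ0 _ _), mul_comm]
  have hqη : ∀ t ∈ Icc a b,
      ‖traj a b α (r ε).1 (fun _ => k) t + (rlOp a b α (d ε) t, 0)‖ ≤ η ε := by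
    intro t ht
    refine (hq t ht).trans ?_
    have := mul_le_mul_of_nonneg_right (hσle ε hε t) (norm_nonneg v₀)
    simp only [hη]
    linarith
  have hdn : ∀ t, ‖d ε t‖ = ‖v₀‖ * χ ε t := fun t => by
    simp only [hd]
    rw [norm_smul, Real.norm_of_nonneg (hχ0 _ _), mul_comm]
  have hd1 : ∀ t, ‖d ε t‖ ≤ ‖v₀‖ := fun t => by
    rw [hdn]
    refine mul_le_of_le_one_right (norm_nonneg _) ?_
    exact indicator_le_self' (fun _ _ => zero_le_one) t
  have key := hC (r ε).1 (fun _ => k) (d ε) hkb (hdb ε)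
    (fun t _ => (hd1 t).trans (le_max_right _ _))
    (fun t ht => ((hqη t ht).trans hη1.le).trans (le_max_left _ _))
    (by rw [hend, hgε, hgy, add_zero]; exact hy₀)
  -- The multiplier identity replaces the full first variation by ψ · g'(ρ(y ε)), which is o(ε)
  -- because g'(y ε) = 0. Only the excess remains at order ε.
  rw [hψ _ _ ((hdb ε).add hkb), hend] at key
  have hexc : ∫ t in Icc a b, w t * (L (p t + (0, d ε t)) t - L (p t) t - G (p t) t (0, d ε t)) =
      ∫ t in Icc τ (τ + ε), X t := by
    rw [← hmulχ ε hε]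
    refine integral_congr_ae (ae_of_all _ fun t => ?_)
    by_cases ht : t ∈ Icc τ (τ + ε)
    · simp [hd, hχ, ht, hX]
    · have h0 : d ε t = 0 := by simp [hd, hχ, ht]
      simp [h0, hχ, ht, show ((0 : E), (0 : E)) = 0 from rfl]
  have hint : ∫ t in Icc a b, w t *
      ((‖d ε t‖ + ‖traj a b α (r ε).1 (fun _ => k) t + (rlOp a b α (d ε) t, 0)‖) *
        ‖traj a b α (r ε).1 (fun _ => k) t + (rlOp a b α (d ε) t, 0)‖) ≤ B ε * η ε := by
    have hQ : BddMeas a b fun t =>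
        ‖traj a b α (r ε).1 (fun _ => k) t + (rlOp a b α (d ε) t, 0)‖ :=
      ((bddMeas_traj hab.le hα hα1 (r ε).1 hkb).add
        (((hdb ε).rlOp hab.le hα hα1).prodMk (BddMeas.const 0))).norm
    have j1 := (hχb ε).integrableOn_mul hw
    have j2 := ((hχb ε).rlOp hab.le hα hα1).integrableOn_mul hw
    have j3 : IntegrableOn (fun t => C₁ * ‖r ε‖ * w t + ‖v₀‖ * (w t * σ ε t)) (Icc a b) :=
      (hw.const_mul _).add (j2.const_mul _)
    have hBe : B ε = ∫ t in Icc a b, (‖v₀‖ * (w t * χ ε t) +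
        (C₁ * ‖r ε‖ * w t + ‖v₀‖ * (w t * σ ε t))) := by
      rw [integral_add (j1.const_mul _) j3, integral_add (hw.const_mul _) (j2.const_mul _),
        integral_const_mul, integral_const_mul, integral_const_mul, hwσ ε hε, hmulχ ε hε]
    rw [hBe, ← integral_mul_const]
    refine setIntegral_mono_on ((((hdb ε).norm.add hQ).mul hQ).integrableOn_mul hw)
      (((j1.const_mul _).add j3).mul_const _) measurableSet_Icc fun t ht => ?_
    have h1 : ‖d ε t‖ + ‖traj a b α (r ε).1 (fun _ => k) t + (rlOp a b α (d ε) t, 0)‖ ≤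
        ‖v₀‖ * χ ε t + (C₁ * ‖r ε‖ + ‖v₀‖ * σ ε t) := add_le_add (hdn t).le (hq t ht)
    have h2 := mul_le_mul h1 (hqη t ht) (norm_nonneg _)
      ((add_nonneg (norm_nonneg _) (norm_nonneg _)).trans h1)
    refine (mul_le_mul_of_nonneg_left h2 (hw0 t ht)).trans_eq ?_
    ring
  have h3 := mul_le_mul_of_nonneg_left hint hC0
  have h4 : inner ℝ ψ (g' (ρ (y ε))) = inner ℝ ψ (g' (ρ (y ε) - y ε)) := by
    rw [map_sub, hgy, sub_zero]
  rw [h4, hexc] at key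
  linarith

end Needle

/-! ### Integrated Euler-Lagrange equation. -/

section EulerLagrange

variable {E : Type*} [NormedAddCommGroup E] [InnerProductSpace ℝ E] [FiniteDimensional ℝ E]
  [MeasurableSpace E] [BorelSpace E] [SecondCountableTopology E] {a b α : ℝ} {w : ℝ → ℝ}
  {G : E × E → ℝ → E × E →L[ℝ] ℝ} {p : ℝ → E × E} {P : E × E →L[ℝ] ℝ}

/-- Stationarity of the first variation, in integrated form. -/
theorem euler_lagrange_of_firstVar_eq_zero (hab : a < b) (hα : 0 < α) (hα1 : α ≤ 1)
    (hw : IntegrableOn w (Icc a b)) {ℓ₁ ℓ₂ : ℝ → E} (hℓ₁ : BddMeas a b ℓ₁) (hℓ₂ : BddMeas a b ℓ₂)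
    (hG : ∀ t y v, G (p t) t (y, v) = inner ℝ (ℓ₁ t) y + inner ℝ (ℓ₂ t) v)
    {π₁ π₂ : E} (hP : ∀ y, P y = inner ℝ π₁ y.1 + inner ℝ π₂ y.2)
    (h0 : ∀ c v, BddMeas a b v → firstVar a b α w G p P c v = 0) :
    ((fun t => w t • ℓ₂ t) =ᵐ[volume.restrict (Icc a b)]
      fun t => -rlAdj a b α (fun t => w t • ℓ₁ t) t - rlKernel α b t • π₂) ∧
    π₁ + π₂ + ∫ t in Icc a b, w t • ℓ₁ t = 0 := by
  have hi : ∀ ℓ : ℝ → E, BddMeas a b ℓ → IntegrableOn (fun t => w t • ℓ t) (Icc a b) := by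
    rintro ℓ ⟨hm, M, hM⟩
    exact hw.smul_bdd M hm.aestronglyMeasurable (ae_restrict_of_forall_mem measurableSet_Icc hM)
  have hi₁ := hi ℓ₁ hℓ₁
  have hi₂ := hi ℓ₂ hℓ₂
  have hinner : ∀ {f v : ℝ → E}, IntegrableOn f (Icc a b) → BddMeas a b v →
      IntegrableOn (fun t => inner ℝ (f t) (v t)) (Icc a b) := by
    rintro f v hf ⟨hm, M, hM⟩
    refine (hf.norm.mul_const M).mono' (hf.1.inner hm.aestronglyMeasurable) ?_
    filter_upwards [ae_restrict_of_forall_mem measurableSet_Icc hM] with t ht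
    exact (norm_inner_le_norm _ _).trans (mul_le_mul_of_nonneg_left ht (norm_nonneg _))
  constructor
  · set m : ℝ → E := fun t => rlKernel α b t • π₂ +
      (rlAdj a b α (fun t => w t • ℓ₁ t) t + w t • ℓ₂ t) with hm
    have hKi : IntegrableOn (fun t => rlKernel α b t • π₂) (Icc a b) :=
      (integrableOn_rlKernel hα b a b).smul_const π₂
    have hAi := integrableOn_rlAdj hab.le hα hα1 hi₁
    have hmi : IntegrableOn m (Icc a b) := hKi.add (hAi.add hi₂)
    have key : ∀ v, BddMeas a b v → ∫ t in Icc a b, inner ℝ (m t) (v t) = 0 := by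
      intro v hv
      have h1 := h0 0 v hv
      obtain ⟨hvm, M, hM⟩ := id hv
      have hT := hv.rlOp hab.le hα hα1
      simp only [firstVar, hP, endpt, traj, hG, zero_add, inner_zero_right, mul_add,
        ← real_inner_smul_left] at h1
      rw [integral_add (hinner hi₁ hT) (hinner hi₂ hv),
        integral_inner_rlOp hab.le hα hα1 hi₁ hvm.aestronglyMeasurable hM, rlOp,
        ← integral_inner (integrableOn_rlKernel_smul hα b hvm.aestronglyMeasurable hM)] at h1
      simp only [hm, inner_add_left]
      have j1 := hinner hAi hv
      have j2 := hinner hi₂ hv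
      have j12 : IntegrableOn (fun t => inner ℝ (rlAdj a b α (fun t => w t • ℓ₁ t) t) (v t) +
        inner ℝ (w t • ℓ₂ t) (v t)) (Icc a b) := j1.add j2
      rw [integral_add (hinner hKi hv) j12, integral_add j1 j2]
      simpa only [real_inner_smul_left, real_inner_smul_right] using h1
    have hm0 : m =ᵐ[volume.restrict (Icc a b)] 0 := by
      -- Fundamental lemma, tested on controls equal to z on A and 0 elsewhere.
      refine Integrable.ae_eq_zero_of_forall_setIntegral_eq_zero hmi fun A hA _ => ?_
      refine ext_inner_right ℝ fun z => ?_
      have h2 := key _ ((BddMeas.const z).indicator hA)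
      have h3 : ∀ t, inner ℝ (m t) (A.indicator (fun _ => z) t) =
          A.indicator (fun t => inner ℝ z (m t)) t := fun t => by
        by_cases ht : t ∈ A <;> simp [ht, real_inner_comm]
      simp only [h3] at h2
      rw [integral_indicator hA, integral_inner hmi.integrable.integrableOn] at h2
      rw [real_inner_comm, h2, inner_zero_left]
    filter_upwards [hm0] with t ht
    simp only [hm, Pi.zero_apply] at ht
    rw [eq_comm, ← sub_eq_zero, ← neg_eq_zero, ← ht]
    abel
  · refine ext_inner_right ℝ fun c => ?_
    -- Zero control: the state is translated by c, which gives the balance between the endpoint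
    -- terms.
    have h1 := h0 c (fun _ => 0) (BddMeas.const 0)
    have hz : ∀ t, rlOp a b α (fun _ => (0 : E)) t = 0 := fun t => by simp [rlOp]
    simp only [firstVar, hP, endpt, traj, hG, hz, add_zero, inner_zero_right,
      ← real_inner_smul_left] at h1
    have h2 : ∫ t in Icc a b, inner ℝ (w t • ℓ₁ t) c = inner ℝ (∫ t in Icc a b, w t • ℓ₁ t) c := by
      rw [real_inner_comm, ← integral_inner hi₁]
      simp only [real_inner_comm]
    rw [h2] at h1
    rw [inner_add_left, inner_add_left, inner_zero_left]
    exact h1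

end EulerLagrange

/-! ### From nonnegative excess to a positive semidefinite Hessian. -/

section Legendre

/-- The excess vanishes at v = 0 and is nonnegative, so it has a minimum there. A direction of
negative curvature would contradict this. -/
theorem second_deriv_nonneg_of_excess_nonneg {E : Type*} [NormedAddCommGroup E] [NormedSpace ℝ E]
    {f : E → ℝ} (hf : ContDiff ℝ 2 f) {u : E} (h : ∀ v, 0 ≤ f (u + v) - f u - fderiv ℝ f u v)
    (v : E) : 0 ≤ fderiv ℝ (fderiv ℝ f) u v v := by
  by_contra! hneg
  obtain ⟨D, hD⟩ : ∃ D, D = fderiv ℝ (fderiv ℝ f) u v v := ⟨_, rfl⟩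
  rw [← hD] at hneg
  have hline : ∀ s : ℝ, HasDerivAt (fun s : ℝ => u + s • v) v s := fun s => by
    simpa using ((hasDerivAt_id s).smul_const v).const_add u
  have hfd : Differentiable ℝ f := hf.differentiable (by norm_num)
  have hfd2 : Differentiable ℝ (fderiv ℝ f) :=
    (hf.fderiv_right (m := 1) (by norm_num)).differentiable (by norm_num)
  -- If D < 0, subtracting D/4 · s² leaves k''(0) = D/2 < 0, hence a local maximum with k(0) = 0,
  -- whereas k(s) ≥ -D/4 · s² > 0 for s > 0.
  obtain ⟨k, hk⟩ : ∃ k : ℝ → ℝ, k = fun s => f (u + s • v) - f u - s * fderiv ℝ f u v -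
    D / 4 * s ^ 2 := ⟨_, rfl⟩
  have hk1 : ∀ s, HasDerivAt k (fderiv ℝ f (u + s • v) v - fderiv ℝ f u v - D / 4 * (2 * s)) s := by
    intro s
    have h1 : HasDerivAt (fun s : ℝ => f (u + s • v)) (fderiv ℝ f (u + s • v) v) s :=
      (hfd (u + s • v)).hasFDerivAt.comp_hasDerivAt s (hline s)
    have h2 : HasDerivAt (fun s : ℝ => s * fderiv ℝ f u v) (fderiv ℝ f u v) s := by
      simpa using (hasDerivAt_id s).mul_const (fderiv ℝ f u v)
    have h3 : HasDerivAt (fun s : ℝ => D / 4 * s ^ 2) (D / 4 * (2 * s)) s := by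
      simpa using (hasDerivAt_pow 2 s).const_mul (D / 4)
    rw [hk]
    exact ((h1.sub_const (f u)).sub h2).sub h3
  have hdk : deriv k = fun s => fderiv ℝ f (u + s • v) v - fderiv ℝ f u v - D / 4 * (2 * s) :=
    funext fun s => (hk1 s).deriv
  have hk2 : HasDerivAt (deriv k) (D - D / 4 * 2) 0 := by
    have h0 : HasFDerivAt (fun z => fderiv ℝ f z v)
        ((fderiv ℝ (fderiv ℝ f) u).flip v) (u + (0 : ℝ) • v) := by
      rw [zero_smul, add_zero]
      simpa using (hfd2 u).hasFDerivAt.clm_apply (hasFDerivAt_const v u)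
    have h1 : HasDerivAt (fun s : ℝ => fderiv ℝ f (u + s • v) v) D 0 := by
      rw [hD]
      exact h0.comp_hasDerivAt 0 (hline 0)
    have h3 : HasDerivAt (fun s : ℝ => D / 4 * (2 * s)) (D / 4 * 2) 0 := by
      simpa using ((hasDerivAt_id (0 : ℝ)).const_mul 2).const_mul (D / 4)
    rw [hdk]
    exact (h1.sub_const (fderiv ℝ f u v)).sub h3
  have hmax := isLocalMax_of_deriv_deriv_neg (f := k) (x₀ := 0)
    (by rw [hk2.deriv]; linarith) (by rw [hdk]; simp) (hk1 0).continuousAt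
  have hev : ∀ᶠ s in 𝓝[>] (0 : ℝ), k s ≤ k 0 := nhdsWithin_le_nhds hmax
  obtain ⟨s, hs, hs0⟩ := (hev.and self_mem_nhdsWithin).exists
  have hspos : 0 < s := hs0
  have h3 := h (s • v)
  simp only [hk, map_smul, smul_eq_mul, zero_smul, add_zero, sub_self, zero_mul] at hs h3
  have : 0 < -D / 4 * s ^ 2 := by
    have : 0 < -D := by linarith
    positivity
  nlinarith

theorem posSemidef_hessianMatrix {n : ℕ} {f : Rn n → ℝ} (hf : ContDiff ℝ 2 f) {u : Rn n}
    (h : ∀ v, 0 ≤ f (u + v) - f u - fderiv ℝ f u v) : (hessianMatrix f u).PosSemidef := by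
  refine Matrix.PosSemidef.of_dotProduct_mulVec_nonneg ?_ fun x => ?_
  · ext i k
    have hs : IsSymmSndFDerivAt ℝ f u := hf.contDiffAt.isSymmSndFDerivAt (by simp)
    simp only [Matrix.conjTranspose_apply, hessianMatrix, Matrix.of_apply, star_trivial]
    exact hs _ _
  · have h1 := second_deriv_nonneg_of_excess_nonneg hf h (WithLp.toLp 2 x)
    have hx : WithLp.toLp 2 x = ∑ i, x i • (EuclideanSpace.single i (1 : ℝ) : Rn n) := by
      ext k
      simp [Finset.sum_apply, Pi.single_apply]
    rw [hx] at h1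
    simp only [map_sum, map_smul, sum_apply, smul_apply,
      smul_eq_mul] at h1
    refine h1.trans_eq ?_
    simp only [dotProduct, Matrix.mulVec, hessianMatrix, Matrix.of_apply, Finset.mul_sum,
      star_trivial]
    rw [Finset.sum_comm]
    exact Finset.sum_congr rfl fun i _ => Finset.sum_congr rfl fun k _ => by
      ring

end Legendre

/-! ### Bounded representatives and the Lagrangian with clamped time. -/

/-- A measurable representative is set to 0 wherever it exceeds the essential supremum, so that
bounds hold at every point. -/
theorem exists_bddMeas_ae_eq {E : Type*} [NormedAddCommGroup E] [MeasurableSpace E] [BorelSpace E]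
    {a b : ℝ} {f : ℝ → E} (hf : MemLp f ⊤ (volume.restrict (Icc a b))) :
    ∃ u : ℝ → E, BddMeas a b u ∧ f =ᵐ[volume.restrict (Icc a b)] u := by
  obtain ⟨f', hf', hff'⟩ := hf.1
  set C := (eLpNormEssSup f (volume.restrict (Icc a b))).toReal with hC
  have hfin : eLpNormEssSup f (volume.restrict (Icc a b)) ≠ ⊤ := by
    have := hf.2
    rw [eLpNorm_exponent_top] at this
    exact this.ne
  have hs : MeasurableSet {t | ‖f' t‖ ≤ C} := measurableSet_le hf'.norm.measurable measurable_const
  refine ⟨{t | ‖f' t‖ ≤ C}.indicator f', ⟨hf'.measurable.indicator hs, C, fun t _ => ?_⟩, ?_⟩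
  · by_cases ht : t ∈ {t | ‖f' t‖ ≤ C}
    · rw [indicator_of_mem ht]; exact ht
    · rw [indicator_of_notMem ht, norm_zero]; exact ENNReal.toReal_nonneg
  · filter_upwards [hff', enorm_ae_le_eLpNormEssSup f (volume.restrict (Icc a b))] with t h1 h2
    have h3 : ‖f t‖ ≤ C := by
      have := ENNReal.toReal_mono hfin h2
      rwa [toReal_enorm] at this
    rw [indicator_of_mem (show t ∈ {t | ‖f' t‖ ≤ C} by simpa [← h1] using h3), h1]

section Lagrangian

variable {n : ℕ} {a b : ℝ} {L : Rn n × Rn n × ℝ → ℝ}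

/-- The Lagrangian with time clamped to `[a, b]`. -/
noncomputable def clampL (hab : a ≤ b) (L : Rn n × Rn n × ℝ → ℝ) (p : Rn n × Rn n) (t : ℝ) : ℝ :=
  L (p.1, p.2, (projIcc a b hab t : ℝ))

/-- The derivative of the clamped Lagrangian in the state and the control. -/
noncomputable def clampG (hab : a ≤ b) (L : Rn n × Rn n × ℝ → ℝ) (p : Rn n × Rn n) (t : ℝ) :
    Rn n × Rn n →L[ℝ] ℝ :=
  (fderivWithin ℝ L (univ ×ˢ univ ×ˢ Icc a b) (p.1, p.2, (projIcc a b hab t : ℝ))).comp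
    ((ContinuousLinearMap.fst ℝ (Rn n) (Rn n)).prod
      ((ContinuousLinearMap.snd ℝ (Rn n) (Rn n)).prod 0))

/-- L is C² only for times in [a, b]. Clamping yields joint continuity for all times and leaves the
first two variables free, so derivatives within the slab become full partial derivatives. -/
theorem isSmoothIntegrand_clamp (hab : a < b)
    (hL : ContDiffOn ℝ 2 L (univ ×ˢ univ ×ˢ Icc a b)) :
    IsSmoothIntegrand (clampL hab.le L) (clampG hab.le L) := by
  have hU : UniqueDiffOn ℝ ((univ : Set (Rn n)) ×ˢ (univ : Set (Rn n)) ×ˢ Icc a b) :=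
    uniqueDiffOn_univ.prod (uniqueDiffOn_univ.prod (uniqueDiffOn_Icc hab))
  have hmem : ∀ (p : Rn n × Rn n) t, (p.1, p.2, (projIcc a b hab.le t : ℝ)) ∈
      (univ : Set (Rn n)) ×ˢ (univ : Set (Rn n)) ×ˢ Icc a b := fun p t =>
    ⟨mem_univ _, mem_univ _, (projIcc a b hab.le t).2⟩
  have hcont : Continuous fun z : (Rn n × Rn n) × ℝ =>
      (z.1.1, z.1.2, (projIcc a b hab.le z.2 : ℝ)) := by
    have : Continuous fun z : (Rn n × Rn n) × ℝ => (projIcc a b hab.le z.2 : ℝ) :=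
      continuous_subtype_val.comp (continuous_projIcc.comp continuous_snd)
    fun_prop
  have hD1 := hL.fderivWithin hU (m := 1) (by norm_num)
  refine ⟨?_, ?_, ?_, ?_⟩
  · exact hL.continuousOn.comp_continuous hcont fun z => hmem z.1 z.2
  · exact ((hD1.continuousOn).comp_continuous hcont fun z => hmem z.1 z.2).clm_comp
      continuous_const
  · intro p t
    have h1 := (hL.differentiableOn (by norm_num) _ (hmem p t)).hasFDerivWithinAt
    have h2 : HasFDerivAt (fun p : Rn n × Rn n => (p.1, p.2, (projIcc a b hab.le t : ℝ)))
        ((ContinuousLinearMap.fst ℝ (Rn n) (Rn n)).prod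
          ((ContinuousLinearMap.snd ℝ (Rn n) (Rn n)).prod 0)) p :=
      hasFDerivAt_fst.prodMk (hasFDerivAt_snd.prodMk (hasFDerivAt_const _ _))
    exact h1.comp_hasFDerivAt p h2 (Eventually.of_forall fun p => hmem p t)
  · intro M
    set Q := Metric.closedBall (0 : Rn n) M ×ˢ Metric.closedBall (0 : Rn n) M ×ˢ Icc a b with hQ
    have hQs : Q ⊆ univ ×ˢ univ ×ˢ Icc a b :=
      prod_mono (subset_univ _) (prod_mono (subset_univ _) Subset.rfl)
    -- The derivative is C¹ on a compact convex set, hence Lipschitz there, uniformly in time.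
    obtain ⟨K, hK⟩ := (hD1.mono hQs).exists_lipschitzOnWith (by norm_num)
      ((convex_closedBall _ _).prod ((convex_closedBall _ _).prod (convex_Icc a b)))
      ((isCompact_closedBall _ _).prod ((isCompact_closedBall _ _).prod isCompact_Icc))
    set J := (ContinuousLinearMap.fst ℝ (Rn n) (Rn n)).prod
      ((ContinuousLinearMap.snd ℝ (Rn n) (Rn n)).prod (0 : Rn n × Rn n →L[ℝ] ℝ)) with hJ
    refine ⟨K * ‖J‖, by positivity, fun t p p' hp hp' => ?_⟩
    have hin : ∀ p : Rn n × Rn n, ‖p‖ ≤ M → (p.1, p.2, (projIcc a b hab.le t : ℝ)) ∈ Q :=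
      fun p hp => ⟨by simpa using (norm_fst_le p).trans hp,
        by simpa using (norm_snd_le p).trans hp, (projIcc a b hab.le t).2⟩
    have h1 := hK.dist_le_mul _ (hin p hp) _ (hin p' hp')
    have h2 : dist (p.1, p.2, (projIcc a b hab.le t : ℝ))
        (p'.1, p'.2, (projIcc a b hab.le t : ℝ)) = ‖p - p'‖ := by
      rw [← dist_eq_norm]
      simp [Prod.dist_eq]
    rw [h2, dist_eq_norm] at h1
    rw [clampG, clampG, ← ContinuousLinearMap.sub_comp]
    refine (ContinuousLinearMap.opNorm_comp_le _ _).trans ?_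
    refine (mul_le_mul_of_nonneg_right h1 (norm_nonneg J)).trans_eq ?_
    ring

theorem clampL_of_mem (hab : a ≤ b) {t : ℝ} (ht : t ∈ Icc a b) (p : Rn n × Rn n) :
    clampL hab L p t = L (p.1, p.2, t) := by
  rw [clampL, projIcc_of_mem hab ht]

theorem hasFDerivAt_lagrangian (hab : a < b) (hL : ContDiffOn ℝ 2 L (univ ×ˢ univ ×ˢ Icc a b))
    {t : ℝ} (ht : t ∈ Icc a b) (p : Rn n × Rn n) :
    HasFDerivAt (fun p : Rn n × Rn n => L (p.1, p.2, t)) (clampG hab.le L p t) p := by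
  have h := (isSmoothIntegrand_clamp hab hL).hasFDerivAt p t
  simpa only [clampL_of_mem hab.le ht] using h

theorem hasFDerivAt_lagrangian_fst (hab : a < b) (hL : ContDiffOn ℝ 2 L (univ ×ˢ univ ×ˢ Icc a b))
    {t : ℝ} (ht : t ∈ Icc a b) (y v : Rn n) :
    HasFDerivAt (fun y => L (y, v, t))
      ((clampG hab.le L (y, v) t).comp (ContinuousLinearMap.inl ℝ (Rn n) (Rn n))) y :=
  HasFDerivAt.comp (f := fun y => (y, v)) (g := fun p : Rn n × Rn n => L (p.1, p.2, t)) y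
    (hasFDerivAt_lagrangian hab hL ht (y, v)) (hasFDerivAt_prodMk_left y v)

theorem hasFDerivAt_lagrangian_snd (hab : a < b) (hL : ContDiffOn ℝ 2 L (univ ×ˢ univ ×ˢ Icc a b))
    {t : ℝ} (ht : t ∈ Icc a b) (y v : Rn n) :
    HasFDerivAt (fun v => L (y, v, t))
      ((clampG hab.le L (y, v) t).comp (ContinuousLinearMap.inr ℝ (Rn n) (Rn n))) v :=
  (hasFDerivAt_lagrangian hab hL ht (y, v)).comp v (hasFDerivAt_prodMk_right y v)

end Lagrangian

theorem inner_toDual_symm {E : Type*} [NormedAddCommGroup E] [InnerProductSpace ℝ E]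
    [CompleteSpace E] (A : E →L[ℝ] ℝ) (z : E) :
    inner ℝ ((InnerProductSpace.toDual ℝ E).symm A) z = A z :=
  InnerProductSpace.toDual_symm_apply

end FracBolza

/-! ### Assembly of the theorem. -/

theorem theorem2 (n j : ℕ) (hn : 1 ≤ n) (hj : 1 ≤ j) (a b α β : ℝ) (hab : a < b)
    (hα : 0 < α) (hα1 : α ≤ 1) (hβ : 0 < β)
    (φ : Rn n × Rn n → ℝ) (hφ : ContDiff ℝ 2 φ)
    (L : Rn n × Rn n × ℝ → ℝ) (hL : ContDiffOn ℝ 2 L (univ ×ˢ univ ×ˢ Icc a b))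
    (g : Rn n × Rn n → Rn j) (hg : ContDiff ℝ 1 g)
    (S : Set (Rn j)) (hSne : S.Nonempty) (hSc : IsClosed S) (hSconv : Convex ℝ S)
    (x : ℝ → Rn n) (hx : x ∈ constraintSet a b α g S)
    (hmin : ∀ z ∈ constraintSet a b α g S, bolza a b α β φ L x ≤ bolza a b α β φ L z)
    (hreg : Function.Surjective (fderiv ℝ g (x a, x b))) :
    -- Euler-Lagrange equation
    (RightAC a b α (momentum a b α β L x) ∧
      ∀ᵐ t ∂(volume.restrict (Icc a b)),
        rightRLDeriv a b α (momentum a b α β L x) t =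
          -(((b - t) ^ (β - 1) / Real.Gamma β) •
            gradL₁ L (x t) (caputoDeriv a b α x t) t)) ∧
    -- transversality conditions
    (∃ ψ : Rn j, -ψ ∈ normalCone S (g (x a, x b)) ∧
      contRep a b (rightRLIntegral b (1 - α) (momentum a b α β L x)) a =
        gradient (fun y => φ (y, x b)) (x a) -
          ContinuousLinearMap.adjoint (fderiv ℝ (fun y => g (y, x b)) (x a)) ψ ∧
      -contRep a b (rightRLIntegral b (1 - α) (momentum a b α β L x)) b =
        gradient (fun y => φ (x a, y)) (x b) -
          ContinuousLinearMap.adjoint (fderiv ℝ (fun y => g (x a, y)) (x b)) ψ) ∧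
    -- Legendre condition
    (∀ᵐ t ∂(volume.restrict (Icc a b)),
      (((b - t) ^ (β - 1) / Real.Gamma β) •
        hessianMatrix (fun v => L (x t, v, t)) (caputoDeriv a b α x t)).PosSemidef) := by
  obtain ⟨hxK, hxS⟩ := hx
  have hxc := hxK.1
  have hsm := isSmoothIntegrand_clamp hab hL
  obtain ⟨u, hu, hux⟩ := exists_bddMeas_ae_eq hxK.2.2
  set w : ℝ → ℝ := fun t => (b - t) ^ (β - 1) / Real.Gamma β with hw
  have hΓ := Real.Gamma_pos_of_pos hβ
  have hwi : IntegrableOn w (Icc a b) :=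
    (intervalIntegrable_iff_integrableOn_Icc_of_le hab.le).1 (intervalIntegrable_rpow_sub hβ a b)
  have hw0 : ∀ t ∈ Icc a b, 0 ≤ w t := fun t ht =>
    div_nonneg (Real.rpow_nonneg (sub_nonneg.2 ht.2) _) hΓ.le
  -- the reference process
  set p : ℝ → Rn n × Rn n := fun t => (x (projIcc a b hab.le t), u t) with hp
  have hpx : ∀ t ∈ Icc a b, (p t).1 = x t := fun t ht => by
    simp only [hp, projIcc_of_mem hab.le ht]
  have hpb : BddMeas a b p := by
    refine BddMeas.prodMk ⟨?_, ?_⟩ hu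
    · exact (hxc.domRestrict.comp continuous_projIcc).measurable
    · obtain ⟨M, hM⟩ := isCompact_Icc.exists_bound_of_continuousOn hxc
      exact ⟨M, fun t _ => hM _ (projIcc a b hab.le t).2⟩
  set y₀ : Rn n × Rn n := (x a, x b) with hy₀
  have hbolza : ∀ z : ℝ → Rn n, bolza a b α β φ L z =
      φ (z a, z b) + ∫ t in Icc a b, w t * L (z t, caputoDeriv a b α z t, t) := by
    intro z
    rw [bolza, leftRLIntegral, if_neg hβ.ne', intervalIntegral.integral_of_le hab.le,
      integral_Icc_eq_integral_Ioc]
    rfl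
  -- Each (c, v) is tested against the competitor x + c + I[v], whose Caputo derivative is u + v
  -- almost everywhere.
  have hopt : IsOptimal a b α w (clampL hab.le L) p φ g S y₀ := by
    rintro c v ⟨hvm, M, hM⟩ hgS
    obtain ⟨hz, hzd⟩ := CaputoACInf.add_rlOp hab hα hα1 hxK c hvm.aestronglyMeasurable hM
    set z : ℝ → Rn n := fun t => x t + (c + rlOp a b α v t) with hzdef
    have hzab : (z a, z b) = y₀ + endpt a b α c v := by
      simp [hzdef, hy₀, endpt, rlOp_left]
    have h1 := hmin z ⟨hz, by rw [hzab]; exact hgS⟩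
    rw [hbolza, hbolza, hzab] at h1
    have e1 : ∫ t in Icc a b, w t * L (x t, caputoDeriv a b α x t, t) =
        ∫ t in Icc a b, w t * clampL hab.le L (p t) t := by
      refine integral_congr_ae ?_
      filter_upwards [hux, ae_restrict_mem measurableSet_Icc] with t ht htI
      rw [clampL_of_mem hab.le htI, hpx t htI, ht]
    have e2 : ∫ t in Icc a b, w t * L (z t, caputoDeriv a b α z t, t) =
        ∫ t in Icc a b, w t * clampL hab.le L (p t + traj a b α c v t) t := by
      refine integral_congr_ae ?_
      filter_upwards [hux, hzd, ae_restrict_mem measurableSet_Icc] with t ht hzt htI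
      rw [clampL_of_mem hab.le htI, Prod.fst_add, hpx t htI, hzt, ht]
      rfl
    rwa [e1, e2] at h1
  -- multipliers
  set φ' := fderiv ℝ φ y₀ with hφ'
  set g' := fderiv ℝ g y₀ with hg'
  have hφd : HasFDerivAt φ φ' y₀ := (hφ.differentiable (by norm_num) y₀).hasFDerivAt
  have hgd : HasFDerivAt g g' y₀ := (hg.differentiable (by norm_num) y₀).hasFDerivAt
  have hgs : HasStrictFDerivAt g g' y₀ := hg.contDiffAt.hasStrictFDerivAt (by norm_num)
  obtain ⟨R₀, hR₀⟩ := g'.toLinearMap.exists_rightInverse_of_surjective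
    (LinearMap.range_eq_top.2 hreg)
  set R : Rn j →L[ℝ] Rn n × Rn n := LinearMap.toContinuousLinearMap R₀
  have hR : ∀ z, g' (R z) = z := fun z => LinearMap.congr_fun hR₀ z
  obtain ⟨ρ, hρ, hρ0, hρg⟩ := exists_rectification hgs hR
  obtain ⟨ψ, hψS, hψ⟩ := hopt.exists_multiplier hab hα hα1 hsm hwi hw0 hpb hφd hρ hρ0 hρg hSconv
    hxS hR
  have hexc := fun v₀ => hopt.ae_excess_nonneg hab hα hα1 hsm hwi hw0 hpb hφd hρ hρ0 hρg
    hxS hR hψ v₀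
  -- gradients
  set D := (InnerProductSpace.toDual ℝ (Rn n)).symm with hD
  set ι₁ := ContinuousLinearMap.inl ℝ (Rn n) (Rn n)
  set ι₂ := ContinuousLinearMap.inr ℝ (Rn n) (Rn n)
  have hsplit : ∀ A : Rn n × Rn n →L[ℝ] ℝ, ∀ y v,
      A (y, v) = inner ℝ (D (A.comp ι₁)) y + inner ℝ (D (A.comp ι₂)) v := by
    intro A y v
    rw [hD, inner_toDual_symm, inner_toDual_symm]
    simp [ι₁, ι₂, ← map_add]
  set ℓ₁ : ℝ → Rn n := fun t => D ((clampG hab.le L (p t) t).comp ι₁) with hℓ₁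
  set ℓ₂ : ℝ → Rn n := fun t => D ((clampG hab.le L (p t) t).comp ι₂) with hℓ₂
  have hℓ : ∀ ι : Rn n →L[ℝ] Rn n × Rn n,
      BddMeas a b fun t => D ((clampG hab.le L (p t) t).comp ι) := fun ι =>
    hpb.comp_continuous (f := fun z => D ((clampG hab.le L z.1 z.2).comp ι))
      (D.continuous.comp (hsm.continuous_deriv.clm_comp continuous_const))
  -- Absorbing the multiplier into the endpoint form makes the first variation vanish identically.
  set P : Rn n × Rn n →L[ℝ] ℝ := φ' - (innerSL ℝ ψ).comp g' with hP
  have hPz : ∀ c v, BddMeas a b v → firstVar a b α w (clampG hab.le L) p P c v = 0 := by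
    intro c v hv
    have h1 := hψ c v hv
    simp only [firstVar] at h1 ⊢
    simp only [hP, sub_apply, ContinuousLinearMap.comp_apply, innerSL_apply_apply]
    linarith
  obtain ⟨hEL, hsum⟩ := euler_lagrange_of_firstVar_eq_zero hab hα hα1 hwi (hℓ ι₁) (hℓ ι₂)
    (fun t y v => hsplit (clampG hab.le L (p t) t) y v) (fun y => hsplit P y.1 y.2) hPz
  have hgrad : ∀ᵐ t ∂(volume.restrict (Icc a b)),
      gradL₁ L (x t) (caputoDeriv a b α x t) t = ℓ₁ t ∧
      gradL₂ L (x t) (caputoDeriv a b α x t) t = ℓ₂ t := by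
    filter_upwards [hux, ae_restrict_mem measurableSet_Icc] with t ht htI
    have e : p t = (x t, u t) := Prod.ext (hpx t htI) rfl
    rw [ht, gradL₁, gradL₂, gradient, gradient,
      (hasFDerivAt_lagrangian_fst hab hL htI (x t) (u t)).fderiv,
      (hasFDerivAt_lagrangian_snd hab hL htI (x t) (u t)).fderiv]
    simp only [hℓ₁, hℓ₂, e]
    exact ⟨rfl, rfl⟩
  have hwℓ : ∀ ι : Rn n →L[ℝ] Rn n × Rn n,
      IntegrableOn (fun t => w t • D ((clampG hab.le L (p t) t).comp ι)) (Icc a b) := by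
    intro ι
    obtain ⟨hm, M, hM⟩ := hℓ ι
    exact hwi.smul_bdd M hm.aestronglyMeasurable (ae_restrict_of_forall_mem measurableSet_Icc hM)
  have hq : momentum a b α β L x =ᵐ[volume.restrict (Icc a b)] fun t => w t • ℓ₂ t := by
    filter_upwards [hgrad] with t ht
    rw [momentum, ht.2]
  obtain ⟨hac, hder, hrep⟩ := RightAC.of_ae_eq hab hα hα1 (D (P.comp ι₂))
    ((hwℓ ι₂).congr hq.symm) (hwℓ ι₁) (hq.trans hEL)
  have hπ : ∀ ι : Rn n →L[ℝ] Rn n × Rn n, D (P.comp ι) = D (φ'.comp ι) -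
      ContinuousLinearMap.adjoint (g'.comp ι) ψ := by
    intro ι
    refine ext_inner_right ℝ fun z => ?_
    rw [inner_sub_left, ContinuousLinearMap.adjoint_inner_left, hD, inner_toDual_symm,
      inner_toDual_symm]
    simp [hP]
  have hφ₁ : HasFDerivAt (fun y => φ (y, x b)) (φ'.comp ι₁) (x a) :=
    hφd.comp (x a) (hasFDerivAt_prodMk_left (x a) (x b))
  have hφ₂ : HasFDerivAt (fun y => φ (x a, y)) (φ'.comp ι₂) (x b) :=
    hφd.comp (x b) (hasFDerivAt_prodMk_right (x a) (x b))
  have hg₁ : HasFDerivAt (fun y => g (y, x b)) (g'.comp ι₁) (x a) :=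
    hgd.comp (x a) (hasFDerivAt_prodMk_left (x a) (x b))
  have hg₂ : HasFDerivAt (fun y => g (x a, y)) (g'.comp ι₂) (x b) :=
    hgd.comp (x b) (hasFDerivAt_prodMk_right (x a) (x b))
  refine ⟨⟨hac, ?_⟩, ⟨ψ, ?_, ?_, ?_⟩, ?_⟩
  · filter_upwards [hder, hgrad] with t h1 h2
    rw [h1, h2.1]
  · intro z hz
    rw [inner_neg_left]
    linarith [hψS z hz]
  · rw [hrep (left_mem_Icc.2 hab.le), gradient, hφ₁.fderiv, hg₁.fderiv, ← hD, ← hπ ι₁]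
    beta_reduce
    rw [intervalIntegral.integral_of_le hab.le, ← integral_Icc_eq_integral_Ioc]
    -- At a the representative equals -∫ w ℓ₁ - π₂, which is π₁ by the balance obtained from
    -- translations.
    rw [eq_comm, ← sub_eq_zero, ← hsum]
    abel
  · rw [hrep (right_mem_Icc.2 hab.le), gradient, hφ₂.fderiv, hg₂.fderiv, ← hD, ← hπ ι₂]
    simp
  · have hall : ∀ᵐ τ ∂(volume.restrict (Icc a b)), ∀ v₀ : Rn n,
        0 ≤ w τ * (clampL hab.le L (p τ + (0, v₀)) τ - clampL hab.le L (p τ) τ -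
          clampG hab.le L (p τ) τ (0, v₀)) := by
      -- The exceptional null set depends on v₀; a dense sequence and continuity in v₀ give a single
      -- one.
      have h1 := ae_all_iff.2 fun k => hexc (TopologicalSpace.denseSeq (Rn n) k)
      filter_upwards [h1] with τ hτ v₀
      refine (TopologicalSpace.denseRange_denseSeq (Rn n)).induction_on v₀ ?_ hτ
      refine isClosed_le continuous_const (continuous_const.mul ((Continuous.sub ?_
        continuous_const).sub ?_))
      · exact hsm.continuous.comp (f := fun v : Rn n => (p τ + (0, v), τ)) (by fun_prop)
      · exact (clampG hab.le L (p τ) τ).continuous.comp (by fun_prop)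
    filter_upwards [hall, hux, ae_Icc_mem_Ioo a b] with t ht htu htI
    have htI' := Ioo_subset_Icc_self htI
    have hwt : 0 < w t := div_pos (Real.rpow_pos_of_pos (sub_pos.2 htI.2) _) hΓ
    refine Matrix.PosSemidef.smul (posSemidef_hessianMatrix ?_ fun v => ?_) hwt.le
    · have h2 : ContDiff ℝ 2 fun v : Rn n => (x t, v, t) := by fun_prop
      exact contDiffOn_univ.1 (hL.comp h2.contDiffOn fun v _ => ⟨mem_univ _, mem_univ _, htI'⟩)
    · have e : p t = (x t, u t) := Prod.ext (hpx t htI') rfl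
      -- The weight is positive for t < b and can be divided out.
      have h3 := nonneg_of_mul_nonneg_right (ht v) hwt
      rw [clampL_of_mem hab.le htI', clampL_of_mem hab.le htI', e] at h3
      rw [htu, (hasFDerivAt_lagrangian_snd hab hL htI' (x t) (u t)).fderiv]
      simpa using h3
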